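/- Let $n\ge 3$ be an integer, $a\in[0,1)$, and put $p=\frac{2n}{n-2+2a}$, $\omega_n=\frac{\pi^{n/2}}{\Gamma(n/2+1)}$ (the volume of the unit ball of $\mathbb R^n$) and $$K_a=\left(\frac{1}{(n-2)(n-ap)}\right)^{\frac12}\left(\frac{(2-ap)\,\Gamma\!\left(\frac{2n-2ap}{2-ap}\right)}{n\omega_n\,\Gamma\!\left(\frac{n-ap}{2-ap}\right)^2}\right)^{\frac{2-ap}{2n-2ap}}.$$ Let $(X,d)$ be a proper metric space (closed bounded sets are compact), let $\mu$ be a Borel measure on $X$ with $0<\mu(U)<\infty$ for every nonempty bounded open set $U\subset X$, and let $x_0\in X$, $C\ge K_a$ and $C_0\ge 1$. Write $B(x,r)=\{y\in X: d(x,y)<r\}$, $\mathbb B_n(r)=\{x\in\mathbb R^n:|x|<r\}$, and let $\mu_E$ be the Lebesgue measure on $\mathbb R^n$. Assume the following. * $(\mathrm{CKN})^{x_0}_C$: for every Lipschitz function $u:X\to\mathbb R$ with compact support, $$\left(\int_X\frac{|u(x)|^p}{d(x_0,x)^{ap}}\,d\mu(x)\right)^{1/p}\le C\left(\int_X|Du|(x)^2\,d\mu(x)\right)^{1/2},$$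 where $|Du|(x)=\limsup_{y\to x}\frac{|u(y)-u(x)|}{d(x,y)}$ (equal to $0$ if $x$ is isolated). * $(\mathrm{VD})^n_{C_0}$: $\displaystyle\frac{\mu(B(x,R))}{\mu(B(x,r))}\le C_0\left(\frac Rr\right)^n$ for all $x\in X$ and $0<r<R$. * $(\mathrm{AR})^n_{x_0}$: $\displaystyle\liminf_{r\to0^+}\frac{\mu(B(x_0,r))}{\mu_E(\mathbb B_n(r))}=1$. Then, for every $x\in X$ and $\rho>0$, $$\mu(B(x,\rho))\ge C_0^{-1}\,(C^{-1}K_a)^{\frac{n}{1-a}}\,\mu_E(\mathbb B_n(\rho)).$$ In particular, $(X,d,\mu)$ has $n$-dimensional volume growth: for all $\rho>0$, $$C_0^{-1}\,(C^{-1}K_a)^{\frac{n}{1-a}}\,\omega_n\rho^n\le\mu(B(x_0,\rho))\le C_0\,\omega_n\rho^n.$$ -/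

import Mathlib

open MeasureTheory Filter Topology
open scoped ENNReal

noncomputable section

/-- The exponent `p = 2n / (n - 2 + 2a)`. -/
def cknExponent (n : ℕ) (a : ℝ) : ℝ := 2 * (n : ℝ) / ((n : ℝ) - 2 + 2 * a)

/-- `ω_n = π^{n/2} / Γ(n/2 + 1)`, the volume of the unit ball of `ℝⁿ`. -/
def unitBallVolume (n : ℕ) : ℝ :=
  Real.pi ^ ((n : ℝ) / 2) / Real.Gamma ((n : ℝ) / 2 + 1)

/-- The optimal constant `K_a` of the Euclidean Caffarelli-Kohn-Nirenberg inequality in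
dimension `n`. -/
def cknConstant (n : ℕ) (a : ℝ) : ℝ :=
  let p := cknExponent n a
  (1 / (((n : ℝ) - 2) * ((n : ℝ) - a * p))) ^ ((1 : ℝ) / 2) *
    ((2 - a * p) * Real.Gamma ((2 * n - 2 * (a * p)) / (2 - a * p)) /
        ((n : ℝ) * unitBallVolume n *
          Real.Gamma (((n : ℝ) - a * p) / (2 - a * p)) ^ 2)) ^
      ((2 - a * p) / (2 * n - 2 * (a * p)))

/-- Lebesgue measure of the open ball `𝔹_n(r) = {x ∈ ℝⁿ : |x| < r}` (Euclidean norm). -/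
def euclideanBallVolume (n : ℕ) (r : ℝ) : ℝ≥0∞ :=
  volume (Metric.ball (0 : EuclideanSpace ℝ (Fin n)) r)

/-- The measure of every nonempty bounded open set is positive and finite. -/
def PosFiniteOnBoundedOpen {X : Type*} [MetricSpace X] [MeasurableSpace X]
    (μ : Measure X) : Prop :=
  ∀ U : Set X, IsOpen U → Bornology.IsBounded U → U.Nonempty → 0 < μ U ∧ μ U < ∞

/-- Membership in `Lip₀(X)`: Lipschitz real functions with compact support. -/
def IsLipZero {X : Type*} [MetricSpace X] (u : X → ℝ) : Prop :=
  (∃ L, LipschitzWith L u) ∧ HasCompactSupport u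

/-- The local Lipschitz constant `|Du|(x) = limsup_{y → x} |u(y) - u(x)| / d(x, y)`, as an
extended nonnegative number. The limit is over `y ≠ x`; at an isolated point the value is `0`. -/
def localLip {X : Type*} [MetricSpace X] (u : X → ℝ) (x : X) : ℝ≥0∞ :=
  limsup (fun y => edist (u y) (u x) / edist x y) (𝓝[≠] x)

/-- The Caffarelli-Kohn-Nirenberg inequality with base point `x₀` and constant `C`. Both sides
are integrals of nonnegative functions, so they are taken in `[0, ∞]`. -/
def SatisfiesCKN {X : Type*} [MetricSpace X] [MeasurableSpace X] (μ : Measure X)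
    (n : ℕ) (a : ℝ) (x₀ : X) (C : ℝ) : Prop :=
  ∀ u : X → ℝ, IsLipZero u →
    (∫⁻ x, ‖u x‖ₑ ^ cknExponent n a / edist x₀ x ^ (a * cknExponent n a) ∂μ) ^
        (1 / cknExponent n a) ≤
      ENNReal.ofReal C * (∫⁻ x, localLip u x ^ (2 : ℝ) ∂μ) ^ ((1 : ℝ) / 2)

/-- The volume doubling condition with explicit exponent `n` and constant `C₀`. -/
def SatisfiesVD {X : Type*} [MetricSpace X] [MeasurableSpace X] (μ : Measure X)
    (n : ℕ) (C₀ : ℝ) : Prop :=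
  ∀ (x : X) (r R : ℝ), 0 < r → r < R →
    μ (Metric.ball x R) / μ (Metric.ball x r) ≤ ENNReal.ofReal (C₀ * (R / r) ^ n)

/-- `liminf_{r → 0⁺} μ(B(x₀, r)) / μ_E(𝔹_n(r)) = 1`. -/
def SatisfiesAR {X : Type*} [MetricSpace X] [MeasurableSpace X] (μ : Measure X)
    (n : ℕ) (x₀ : X) : Prop :=
  liminf (fun r : ℝ => μ (Metric.ball x₀ r) / euclideanBallVolume n r) (𝓝[>] (0 : ℝ)) = 1

end

/-! Test the inequality on the Euclidean extremals. Put `s = 2 - ap`, `m = n / (2(1 - a))`, `γ = ap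
/ s` and `W = d(x₀, ·) ^ s`. Applied to `(l + W) ^ (1 - m)`, CKN involves only moments of `W`, all
of which come from `F l = ∫ W ^ (-γ) (l + W) ^ (1 - 2m) dμ`. With `A = -F' / (2m - 1)` it reads `A ^
(1 - 1/m) ≤ C² (n - 2)² (F - l A)` (`SatisfiesCKN.moment_inequality`).

The functions `fb * l ^ (1 - m)` turn this into an equality at exactly one level `fb`, and the
formula for `K_a` says that `fb = (K_a / C) ^ (n / (1 - a))` times the Euclidean moment
(`critical_identity`). Where `l ^ (m - 1) * F l` is below `fb` it must increase with `l`
(`normalized_le_of_lt_critical`), so a value below `fb` persists, no larger, as `l → 0`.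

By the layer-cake formula, `l ^ (m - 1) * F l` is a fixed weighted average over `t` of the volume
ratio at radius `(l t) ^ (1/s)`. As `l → 0`, Fatou and (AR) make its lower limit at least the full
Euclidean moment, which is at least `fb` because `C ≥ K_a`. Hence it is never below `fb`
(`critical_le_moment`). As `l → ∞` the average sees only large balls, which doubling compares with
any fixed ball `B(x, ρ)` at the cost of `C₀`; this is the lower bound. The upper bound needs only
doubling and (AR). -/

/-! ### Beta integrals and the radial kernel on the half line. -/

open Set in
theorem lintegral_rpow_mul_exp_neg_mul_Ioi {u r : ℝ} (hu : 0 < u) (hr : 0 < r) :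
    ∫⁻ x in Ioi (0 : ℝ), ENNReal.ofReal (x ^ (u - 1) * Real.exp (-(r * x))) =
      ENNReal.ofReal ((1 / r) ^ u * Real.Gamma u) := by
  have h := Real.integral_rpow_mul_exp_neg_mul_Ioi hu hr
  have hpos : 0 < (1 / r) ^ u * Real.Gamma u :=
    mul_pos (Real.rpow_pos_of_pos (by positivity) _) (Real.Gamma_pos_of_pos hu)
  rw [← h, ofReal_integral_eq_lintegral_ofReal]
  · exact Integrable.of_integral_ne_zero (by rw [h]; exact hpos.ne')
  · filter_upwards [ae_restrict_mem measurableSet_Ioi] with x hx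
    exact mul_nonneg (Real.rpow_nonneg (le_of_lt hx) _) (Real.exp_pos _).le

open Set in
/-- The Euler beta integral over the half line. -/
theorem lintegral_beta_Ioi {u v : ℝ} (hu : 0 < u) (hv : 0 < v) :
    ∫⁻ t in Ioi (0 : ℝ), ENNReal.ofReal (t ^ (u - 1) * (1 + t) ^ (-(u + v))) =
      ENNReal.ofReal (Real.Gamma u * Real.Gamma v / Real.Gamma (u + v)) := by
  have hΓ : 0 < Real.Gamma (u + v) := Real.Gamma_pos_of_pos (by positivity)
  have hc : ENNReal.ofReal (Real.Gamma (u + v)) ≠ 0 := by simpa using hΓ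
  -- Tonelli for `t ^ (u-1) x ^ (u+v-1) exp (-(1+t) x)`: integrating in `x` first gives the beta
  -- integrand times `Γ(u+v)`, integrating in `t` first leaves a Gamma integral.
  have key : ENNReal.ofReal (Real.Gamma (u + v)) *
      ∫⁻ t in Ioi (0 : ℝ), ENNReal.ofReal (t ^ (u - 1) * (1 + t) ^ (-(u + v))) =
      ENNReal.ofReal (Real.Gamma u * Real.Gamma v) := by
    calc
      _ = ∫⁻ t in Ioi (0 : ℝ), ∫⁻ x in Ioi (0 : ℝ), ENNReal.ofReal
            (t ^ (u - 1) * (x ^ (u + v - 1) * Real.exp (-((1 + t) * x)))) := by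
        rw [← lintegral_const_mul' _ _ ENNReal.ofReal_ne_top]
        refine setLIntegral_congr_fun measurableSet_Ioi fun t (ht : 0 < t) => ?_
        have h1 : ∀ x, ENNReal.ofReal
            (t ^ (u - 1) * (x ^ (u + v - 1) * Real.exp (-((1 + t) * x)))) =
            ENNReal.ofReal (t ^ (u - 1)) *
              ENNReal.ofReal (x ^ (u + v - 1) * Real.exp (-((1 + t) * x))) := fun x =>
          ENNReal.ofReal_mul (by positivity)
        simp_rw [h1]
        rw [lintegral_const_mul' _ _ ENNReal.ofReal_ne_top,
          lintegral_rpow_mul_exp_neg_mul_Ioi (by positivity) (by positivity),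
          ← ENNReal.ofReal_mul hΓ.le, ← ENNReal.ofReal_mul (by positivity)]
        congr 1
        rw [one_div, Real.inv_rpow (by positivity), Real.rpow_neg (by positivity)]
        ring
      _ = ∫⁻ x in Ioi (0 : ℝ), ∫⁻ t in Ioi (0 : ℝ), ENNReal.ofReal
            (t ^ (u - 1) * (x ^ (u + v - 1) * Real.exp (-((1 + t) * x)))) := by
        refine lintegral_lintegral_swap (Measurable.aemeasurable ?_)
        unfold Function.uncurry
        fun_prop
      _ = ∫⁻ x in Ioi (0 : ℝ), ENNReal.ofReal (Real.Gamma u) *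
            ENNReal.ofReal (x ^ (v - 1) * Real.exp (-(1 * x))) := by
        refine setLIntegral_congr_fun measurableSet_Ioi fun x (hx : 0 < x) => ?_
        have h1 : ∀ t, ENNReal.ofReal
            (t ^ (u - 1) * (x ^ (u + v - 1) * Real.exp (-((1 + t) * x)))) =
            ENNReal.ofReal (x ^ (u + v - 1) * Real.exp (-x)) *
              ENNReal.ofReal (t ^ (u - 1) * Real.exp (-(x * t))) := fun t => by
          rw [← ENNReal.ofReal_mul (by positivity)]
          congr 1
          rw [show -((1 + t) * x) = -x + -(x * t) by ring, Real.exp_add]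
          ring
        simp_rw [h1]
        rw [lintegral_const_mul' _ _ ENNReal.ofReal_ne_top,
          lintegral_rpow_mul_exp_neg_mul_Ioi hu hx,
          ← ENNReal.ofReal_mul (by positivity), ← ENNReal.ofReal_mul (Real.Gamma_pos_of_pos hu).le]
        congr 1
        rw [one_div, Real.inv_rpow hx.le, show u + v - 1 = (v - 1) + u by ring,
          Real.rpow_add hx, one_mul]
        have := (Real.rpow_pos_of_pos hx u).ne'
        field_simp
      _ = _ := by
        rw [lintegral_const_mul' _ _ ENNReal.ofReal_ne_top,
          lintegral_rpow_mul_exp_neg_mul_Ioi hv one_pos,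
          ← ENNReal.ofReal_mul (Real.Gamma_pos_of_pos hu).le]
        simp
  rw [ENNReal.ofReal_div_of_pos hΓ, ← key, mul_comm, ENNReal.mul_div_cancel_right hc
    ENNReal.ofReal_ne_top]

/-- Minus the derivative of `t ↦ t ^ (-γ) * (1 + t) ^ (1 - 2 * m)`. -/
noncomputable def radialKernel (γ m t : ℝ) : ℝ :=
  γ * t ^ (-γ - 1) * (1 + t) ^ (1 - 2 * m) + (2 * m - 1) * t ^ (-γ) * (1 + t) ^ (-(2 * m))

theorem radialKernel_nonneg {γ m t : ℝ} (hγ : 0 ≤ γ) (hm : 1 < m) (ht : 0 < t) :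
    0 ≤ radialKernel γ m t := by
  have : 0 ≤ 2 * m - 1 := by linarith
  unfold radialKernel
  positivity

@[fun_prop]
theorem measurable_radialKernel (γ m : ℝ) : Measurable (radialKernel γ m) := by
  unfold radialKernel
  fun_prop

theorem hasDerivAt_radialProfile (γ m : ℝ) {t : ℝ} (ht : 0 < t) :
    HasDerivAt (fun t : ℝ => t ^ (-γ) * (1 + t) ^ (1 - 2 * m)) (-radialKernel γ m t) t := by
  have h1 : HasDerivAt (fun t : ℝ => t ^ (-γ)) (-γ * t ^ (-γ - 1)) t :=
    Real.hasDerivAt_rpow_const (Or.inl ht.ne')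
  have h2 : HasDerivAt (fun t : ℝ => (1 + t) ^ (1 - 2 * m))
      (1 * (1 - 2 * m) * (1 + t) ^ (1 - 2 * m - 1)) t :=
    ((hasDerivAt_id t).const_add 1).rpow_const (Or.inl (by simp only [id]; positivity))
  refine (h1.mul h2).congr_deriv ?_
  unfold radialKernel
  rw [show 1 - 2 * m - 1 = -(2 * m) by ring]
  ring

open Set in
theorem lintegral_radialKernel_Ioi {γ m T : ℝ} (hγ : 0 ≤ γ) (hm : 1 < m) (hT : 0 < T) :
    ∫⁻ t in Ioi T, ENNReal.ofReal (radialKernel γ m t) =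
      ENNReal.ofReal (T ^ (-γ) * (1 + T) ^ (1 - 2 * m)) := by
  have hd : ∀ t ∈ Ici T, HasDerivAt (fun t : ℝ => t ^ (-γ) * (1 + t) ^ (1 - 2 * m))
      (-radialKernel γ m t) t := fun t ht => hasDerivAt_radialProfile γ m (hT.trans_le ht)
  have hneg : ∀ t ∈ Ioi T, -radialKernel γ m t ≤ 0 := fun t ht =>
    neg_nonpos.2 (radialKernel_nonneg hγ hm (hT.trans ht))
  have hlim : Tendsto (fun t : ℝ => t ^ (-γ) * (1 + t) ^ (1 - 2 * m)) atTop (𝓝 0) := by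
    have h1 : Tendsto (fun t : ℝ => (1 + t) ^ (-(2 * m - 1))) atTop (𝓝 0) :=
      (tendsto_rpow_neg_atTop (by linarith)).comp (tendsto_atTop_add_const_left _ 1 tendsto_id)
    refine squeeze_zero' ?_ ?_ h1
    · filter_upwards [eventually_gt_atTop 0] with t ht
      positivity
    · filter_upwards [eventually_ge_atTop 1] with t ht
      rw [neg_sub]
      exact mul_le_of_le_one_left (by positivity)
        (Real.rpow_le_one_of_one_le_of_nonpos ht (by linarith))
  have hint := integral_Ioi_of_hasDerivAt_of_nonpos' hd hneg hlim
  have hio := integrableOn_Ioi_deriv_of_nonpos' hd hneg hlim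
  rw [← ofReal_integral_eq_lintegral_ofReal]
  · congr 1
    rw [integral_neg] at hint
    linarith
  · exact (integrable_neg_iff (f := radialKernel γ m)).1 hio
  · filter_upwards [ae_restrict_mem measurableSet_Ioi] with t ht
    exact radialKernel_nonneg hγ hm (hT.trans ht)

-- The two terms of the kernel give the beta integrals with parameters `(m, m - 1)` and `(m + 1, m -
-- 1)`; the functional equation of Gamma merges them. Up to `ω_n`, this is the total mass of the
-- weight that averages the volume ratio.
open Set in
theorem lintegral_radialKernel_mul_rpow {γ m : ℝ} (hγ : 0 ≤ γ) (hm : 1 < m) :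
    ∫⁻ t in Ioi (0 : ℝ), ENNReal.ofReal (radialKernel γ m t * t ^ (m + γ)) =
      ENNReal.ofReal ((m + γ) * (Real.Gamma m * Real.Gamma (m - 1) / Real.Gamma (2 * m - 1))) := by
  have hG1 := Real.Gamma_pos_of_pos (show 0 < m by linarith)
  have hG2 := Real.Gamma_pos_of_pos (show 0 < m - 1 by linarith)
  have hG3 := Real.Gamma_pos_of_pos (show 0 < 2 * m - 1 by linarith)
  have h2m : 0 ≤ 2 * m - 1 := by linarith
  have b1 := lintegral_beta_Ioi (show 0 < m by linarith) (show 0 < m - 1 by linarith)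
  have b2 := lintegral_beta_Ioi (show 0 < m + 1 by linarith) (show 0 < m - 1 by linarith)
  rw [show m + (m - 1) = 2 * m - 1 by ring] at b1
  rw [show m + 1 + (m - 1) = (2 * m - 1) + 1 by ring, Real.Gamma_add_one (by linarith),
    Real.Gamma_add_one (by linarith)] at b2
  calc
    _ = ∫⁻ t in Ioi (0 : ℝ), (ENNReal.ofReal γ *
          ENNReal.ofReal (t ^ (m - 1) * (1 + t) ^ (-(2 * m - 1))) + ENNReal.ofReal (2 * m - 1) *
          ENNReal.ofReal (t ^ (m + 1 - 1) * (1 + t) ^ (-(2 * m - 1 + 1)))) := by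
      refine setLIntegral_congr_fun measurableSet_Ioi fun t (ht : 0 < t) => ?_
      rw [← ENNReal.ofReal_mul hγ, ← ENNReal.ofReal_mul h2m,
        ← ENNReal.ofReal_add (by positivity) (by positivity)]
      congr 1
      have e1 : t ^ (m - 1) = t ^ (-γ - 1) * t ^ (m + γ) := by
        rw [← Real.rpow_add ht]; congr 1; ring
      have e2 : t ^ (m + 1 - 1) = t ^ (-γ) * t ^ (m + γ) := by
        rw [← Real.rpow_add ht]; congr 1; ring
      rw [e1, e2, show -(2 * m - 1) = 1 - 2 * m by ring, show -(2 * m - 1 + 1) = -(2 * m) by ring]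
      unfold radialKernel
      ring
    _ = _ := by
      rw [lintegral_add_left (by fun_prop), lintegral_const_mul' _ _ ENNReal.ofReal_ne_top,
        lintegral_const_mul' _ _ ENNReal.ofReal_ne_top, b1, b2, ← ENNReal.ofReal_mul hγ,
        ← ENNReal.ofReal_mul h2m, ← ENNReal.ofReal_add (by positivity)
          (mul_nonneg h2m (div_nonneg (by positivity) (by positivity)))]
      congr 1
      have : 2 * m - 1 ≠ 0 := by linarith
      generalize Real.Gamma (2 * m - 1) = G at hG3 ⊢
      generalize 2 * m - 1 = d at this ⊢
      field_simp
      ring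

/-! ### Comparison for the differential inequality. -/

/-- Comparison for the differential inequality `(-F' / (2m - 1)) ^ (1 - 1/m) ≤ c (F + λ F' / (2m - 1))`:
below the critical level, the normalized function `l ↦ l ^ (m - 1) * F l` is increasing. -/
theorem normalized_le_of_lt_critical {F A : ℝ → ℝ} {m c fb : ℝ} (hm : 1 < m) (hc : 0 < c)
    (hcrit : ((m - 1) / (2 * m - 1)) ^ (1 - 1 / m) = c * (m / (2 * m - 1)) * fb ^ (1 / m))
    (hF : ∀ l, 0 < l → HasDerivAt F (-(2 * m - 1) * A l) l) (hFpos : ∀ l, 0 < l → 0 < F l)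
    (hA : ∀ l, 0 < l → 0 ≤ A l)
    (hineq : ∀ l, 0 < l → A l ^ (1 - 1 / m) ≤ c * (F l - l * A l))
    {l₁ : ℝ} (hlt : l₁ ^ (m - 1) * F l₁ < fb) {l : ℝ} (hl : 0 < l) (hll : l ≤ l₁) :
    l ^ (m - 1) * F l ≤ l₁ ^ (m - 1) * F l₁ := by
  have hd : ∀ x, 0 < x → HasDerivAt (fun l => l ^ (m - 1) * F l)
      (x ^ (m - 2) * ((m - 1) * F x - (2 * m - 1) * (x * A x))) x := by
    intro x hx
    have h1 : HasDerivAt (fun l : ℝ => l ^ (m - 1)) ((m - 1) * x ^ (m - 1 - 1)) x :=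
      Real.hasDerivAt_rpow_const (Or.inl hx.ne')
    refine (h1.mul (hF x hx)).congr_deriv ?_
    have e : x ^ (m - 1) = x ^ (m - 2) * x := by
      rw [← Real.rpow_add_one hx.ne']; congr 1; ring
    rw [e, show m - 1 - 1 = m - 2 by ring]
    ring
  have hpos : ∀ x, 0 < x → x ^ (m - 1) * F x < fb →
      0 < x ^ (m - 2) * ((m - 1) * F x - (2 * m - 1) * (x * A x)) := by
    intro x hx hxf
    refine mul_pos (Real.rpow_pos_of_pos hx _) ?_
    -- If the derivative were not positive, then `x A ≥ κ F`, hence `F - x A ≤ (1 - κ) F`. Inserting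
    -- both in the differential inequality and using `hcrit` forces `x ^ (m - 1) * F x ≥ fb`.
    by_contra hcon
    have h21 : 0 < 2 * m - 1 := by linarith
    set κ := (m - 1) / (2 * m - 1) with hκ
    have hκ0 : 0 < κ := div_pos (by linarith) h21
    have hκ1 : m / (2 * m - 1) = 1 - κ := by
      rw [hκ, eq_sub_iff_add_eq, ← add_div, div_eq_one_iff_eq h21.ne']; ring
    have hκ1' : 0 < 1 - κ := by rw [← hκ1]; exact div_pos (by linarith) h21
    have hFx := hFpos x hx
    have hxA : κ * F x ≤ x * A x := by
      rw [hκ, div_mul_eq_mul_div, div_le_iff₀ h21]; linarith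
    have he : 0 < 1 - 1 / m := by
      rw [sub_pos, div_lt_one (by linarith)]; exact hm
    have h1 : (κ * F x) ^ (1 - 1 / m) ≤ x ^ (1 - 1 / m) * (c * ((1 - κ) * F x)) := by
      calc (κ * F x) ^ (1 - 1 / m) ≤ (x * A x) ^ (1 - 1 / m) :=
            Real.rpow_le_rpow (by positivity) hxA he.le
        _ = x ^ (1 - 1 / m) * A x ^ (1 - 1 / m) := Real.mul_rpow hx.le (hA x hx)
        _ ≤ x ^ (1 - 1 / m) * (c * (F x - x * A x)) := by
            gcongr; exact hineq x hx
        _ ≤ x ^ (1 - 1 / m) * (c * ((1 - κ) * F x)) := by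
            gcongr; linarith
    rw [Real.mul_rpow hκ0.le hFx.le, hcrit, hκ1] at h1
    have hx1 : x ^ (1 - 1 / m) = (x ^ (m - 1)) ^ (1 / m) := by
      rw [← Real.rpow_mul hx.le]; congr 1; field_simp
    have hF1 : F x = F x ^ (1 - 1 / m) * F x ^ (1 / m) := by
      rw [← Real.rpow_add hFx, sub_add_cancel, Real.rpow_one]
    have hlt' : (x ^ (m - 1) * F x) ^ (1 / m) < fb ^ (1 / m) :=
      Real.rpow_lt_rpow (by positivity) hxf (by positivity)
    rw [Real.mul_rpow (by positivity) hFx.le] at hlt'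
    have h2 : c * (1 - κ) * F x ^ (1 - 1 / m) * fb ^ (1 / m) ≤
        c * (1 - κ) * F x ^ (1 - 1 / m) * ((x ^ (m - 1)) ^ (1 / m) * F x ^ (1 / m)) := by
      calc _ = c * (1 - κ) * fb ^ (1 / m) * F x ^ (1 - 1 / m) := by ring
        _ ≤ _ := h1
        _ = _ := by rw [hx1]; nth_rw 1 [hF1]; ring
    exact absurd (le_of_mul_le_mul_left h2 (by positivity)) (not_le.2 hlt')
  -- Run backwards from `l₁` with `y = l₁ - l`. The barrier is the constant value at `l₁`: the sign
  -- of the derivative is needed only where the function equals it, and there it is below `fb`.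
  have hg : ∀ y ∈ Set.Icc 0 (l₁ - l), HasDerivAt (fun y => (l₁ - y) ^ (m - 1) * F (l₁ - y))
      (-((l₁ - y) ^ (m - 2) * ((m - 1) * F (l₁ - y) - (2 * m - 1) * ((l₁ - y) * A (l₁ - y))))) y := by
    intro y hy
    have := (hd (l₁ - y) (by linarith [hy.2])).comp y ((hasDerivAt_id y).const_sub l₁)
    simpa [Function.comp_def] using this
  have := image_le_of_deriv_right_lt_deriv_boundary'
    (f := fun y => (l₁ - y) ^ (m - 1) * F (l₁ - y)) (a := 0) (b := l₁ - l)
    (fun y hy => (hg y hy).continuousAt.continuousWithinAt)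
    (fun y hy => (hg y ⟨hy.1, hy.2.le⟩).hasDerivWithinAt)
    (B := fun _ => l₁ ^ (m - 1) * F l₁) (B' := fun _ => 0) (by simp) continuousOn_const
    (fun y _ => hasDerivWithinAt_const _ _ _)
    (fun y hy h => neg_lt_zero.2 (hpos _ (by linarith [hy.2]) (h ▸ hlt)))
    (x := l₁ - l) ⟨by linarith, le_rfl⟩
  simpa using this

/-! ### Layer cake, and the moments as functions of `l`. -/

open Set in
/-- Layer-cake formula for the radial profile, after rescaling by `l`. -/
theorem lintegral_radialProfile {Ω : Type*} [MeasurableSpace Ω] {μ : Measure Ω} [SFinite μ]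
    {W : Ω → ℝ} (hW : Measurable W) (hpos : ∀ᵐ x ∂μ, 0 < W x) {γ m l : ℝ} (hγ : 0 ≤ γ)
    (hm : 1 < m) (hl : 0 < l) :
    ∫⁻ x, ENNReal.ofReal (W x ^ (-γ) * (l + W x) ^ (1 - 2 * m)) ∂μ =
      ∫⁻ t in Ioi (0 : ℝ), ENNReal.ofReal (radialKernel γ m t) *
        (ENNReal.ofReal (l ^ (1 - 2 * m - γ)) * μ {x | W x < l * t}) := by
  calc
    _ = ∫⁻ x, (∫⁻ t in Ioi (0 : ℝ), {q : Ω × ℝ | W q.1 < l * q.2}.indicator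
          (fun q => ENNReal.ofReal (l ^ (1 - 2 * m - γ)) *
            ENNReal.ofReal (radialKernel γ m q.2)) (x, t)) ∂μ := by
      refine lintegral_congr_ae ?_
      filter_upwards [hpos] with x hx
      have h1 : ∀ t, {q : Ω × ℝ | W q.1 < l * q.2}.indicator
          (fun q => ENNReal.ofReal (l ^ (1 - 2 * m - γ)) *
            ENNReal.ofReal (radialKernel γ m q.2)) (x, t) =
          (Ioi (W x / l)).indicator (fun t => ENNReal.ofReal (l ^ (1 - 2 * m - γ)) *
            ENNReal.ofReal (radialKernel γ m t)) t := fun t => by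
        simp only [indicator, mem_ofPred_eq, mem_Ioi, div_lt_iff₀' hl]
      simp_rw [h1]
      rw [setLIntegral_indicator measurableSet_Ioi,
        inter_eq_left.2 (Ioi_subset_Ioi (by positivity)),
        lintegral_const_mul' _ _ ENNReal.ofReal_ne_top,
        lintegral_radialKernel_Ioi hγ hm (by positivity), ← ENNReal.ofReal_mul (by positivity)]
      congr 1
      have e : l + W x = l * (1 + W x / l) := by field_simp
      rw [e, Real.mul_rpow hl.le (by positivity), Real.div_rpow hx.le hl.le,
        show 1 - 2 * m - γ = -γ + (1 - 2 * m) by ring, Real.rpow_add hl]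
      have := (Real.rpow_pos_of_pos hl (-γ)).ne'
      field_simp
    _ = ∫⁻ t in Ioi (0 : ℝ), ∫⁻ x, {q : Ω × ℝ | W q.1 < l * q.2}.indicator
          (fun q => ENNReal.ofReal (l ^ (1 - 2 * m - γ)) *
            ENNReal.ofReal (radialKernel γ m q.2)) (x, t) ∂μ := by
      refine lintegral_lintegral_swap (Measurable.aemeasurable ?_)
      refine Measurable.indicator (by fun_prop) ?_
      exact measurableSet_lt (by fun_prop) (by fun_prop)
    _ = _ := by
      refine lintegral_congr fun t => ?_
      have hmeas : MeasurableSet {x | W x < l * t} := measurableSet_lt hW measurable_const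
      have h1 : ∀ x, {q : Ω × ℝ | W q.1 < l * q.2}.indicator
          (fun q => ENNReal.ofReal (l ^ (1 - 2 * m - γ)) *
            ENNReal.ofReal (radialKernel γ m q.2)) (x, t) =
          {x | W x < l * t}.indicator (fun _ => ENNReal.ofReal (l ^ (1 - 2 * m - γ)) *
            ENNReal.ofReal (radialKernel γ m t)) x := fun x => rfl
      simp_rw [h1]
      rw [lintegral_indicator_const hmeas]
      ring

section ResolventMoments

variable {Ω : Type*} [MeasurableSpace Ω] {μ : Measure Ω} {W : Ω → ℝ} {γ m : ℝ}

theorem integrable_rpow_mul_add_rpow_neg (hW : Measurable W) (hpos : ∀ᵐ x ∂μ, 0 < W x) {l : ℝ}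
    (hl : 0 < l) (hint : Integrable (fun x => W x ^ (-γ) * (l + W x) ^ (1 - 2 * m)) μ) :
    Integrable (fun x => W x ^ (-γ) * (l + W x) ^ (-(2 * m))) μ := by
  refine (hint.const_mul l⁻¹).mono' (Measurable.aestronglyMeasurable (by fun_prop)) ?_
  filter_upwards [hpos] with x hx
  rw [Real.norm_of_nonneg (by positivity), show 1 - 2 * m = -(2 * m) + 1 by ring,
    Real.rpow_add_one (by positivity), inv_mul_eq_div, le_div_iff₀ hl]
  have : 0 ≤ W x ^ (-γ) * (l + W x) ^ (-(2 * m)) := by positivity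
  nlinarith

/-- Differentiation under the integral: for parameters above `l / 2` the derivative is dominated by
its size at `l / 2`, which is integrable. -/
theorem hasDerivAt_integral_rpow_mul_add_rpow (hW : Measurable W) (hpos : ∀ᵐ x ∂μ, 0 < W x)
    (hm : 1 < m)
    (hint : ∀ l, 0 < l → Integrable (fun x => W x ^ (-γ) * (l + W x) ^ (1 - 2 * m)) μ)
    {l : ℝ} (hl : 0 < l) :
    HasDerivAt (fun l => ∫ x, W x ^ (-γ) * (l + W x) ^ (1 - 2 * m) ∂μ)
      (-(2 * m - 1) * ∫ x, W x ^ (-γ) * (l + W x) ^ (-(2 * m)) ∂μ) l := by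
  have h2m : 0 < 2 * m - 1 := by linarith
  have := (hasDerivAt_integral_of_dominated_loc_of_deriv_le (𝕜 := ℝ) (μ := μ) (x₀ := l)
    (F := fun l x => W x ^ (-γ) * (l + W x) ^ (1 - 2 * m))
    (F' := fun l x => -(2 * m - 1) * (W x ^ (-γ) * (l + W x) ^ (-(2 * m))))
    (bound := fun x => (2 * m - 1) * (W x ^ (-γ) * (l / 2 + W x) ^ (-(2 * m))))
    (s := Set.Ioi (l / 2)) (Ioi_mem_nhds (by linarith))
    (Eventually.of_forall fun _ => Measurable.aestronglyMeasurable (by fun_prop)) (hint l hl)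
    (Measurable.aestronglyMeasurable (by fun_prop)) ?_
    ((integrable_rpow_mul_add_rpow_neg hW hpos (half_pos hl) (hint _ (half_pos hl))).const_mul _)
    ?_).2
  · rwa [integral_const_mul] at this
  · filter_upwards [hpos] with x hx y hy
    have hy' : l / 2 < y := hy
    have hy0 : 0 < y := by linarith
    rw [norm_mul, norm_neg, Real.norm_of_nonneg h2m.le, Real.norm_of_nonneg (by positivity)]
    gcongr ?_ * (?_ * ?_)
    exact Real.rpow_le_rpow_of_nonpos (by positivity) (by linarith) (by linarith)
  · filter_upwards [hpos] with x hx y hy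
    have hy' : l / 2 < y := hy
    have h1 : HasDerivAt (fun y => (y + W x) ^ (1 - 2 * m))
        (1 * (1 - 2 * m) * (y + W x) ^ (1 - 2 * m - 1)) y :=
      ((hasDerivAt_id y).add_const (W x)).rpow_const (Or.inl (by simp only [id]; linarith))
    refine (h1.const_mul (W x ^ (-γ))).congr_deriv ?_
    rw [show 1 - 2 * m - 1 = -(2 * m) by ring]
    ring

/-- Write one factor `W` as `(l + W) - l`. This expresses the gradient term of CKN through `F` and
`F'`. -/
theorem integral_rpow_one_sub_mul (hW : Measurable W) (hpos : ∀ᵐ x ∂μ, 0 < W x) {l : ℝ}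
    (hl : 0 < l) (hint : Integrable (fun x => W x ^ (-γ) * (l + W x) ^ (1 - 2 * m)) μ) :
    Integrable (fun x => W x ^ (1 - γ) * (l + W x) ^ (-(2 * m))) μ ∧
    ∫ x, W x ^ (1 - γ) * (l + W x) ^ (-(2 * m)) ∂μ =
      ∫ x, W x ^ (-γ) * (l + W x) ^ (1 - 2 * m) ∂μ -
        l * ∫ x, W x ^ (-γ) * (l + W x) ^ (-(2 * m)) ∂μ := by
  have hA := (integrable_rpow_mul_add_rpow_neg hW hpos hl hint).const_mul l
  have hae : (fun x => W x ^ (1 - γ) * (l + W x) ^ (-(2 * m))) =ᵐ[μ] fun x =>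
      W x ^ (-γ) * (l + W x) ^ (1 - 2 * m) - l * (W x ^ (-γ) * (l + W x) ^ (-(2 * m))) := by
    filter_upwards [hpos] with x hx
    rw [show 1 - γ = -γ + 1 by ring, Real.rpow_add_one hx.ne',
      show 1 - 2 * m = -(2 * m) + 1 by ring, Real.rpow_add_one (by positivity)]
    ring
  refine ⟨(hint.sub hA).congr hae.symm, ?_⟩
  rw [integral_congr_ae hae, integral_sub hint hA, integral_const_mul]

end ResolventMoments

/-! ### Admissibility of the extremal profile as a test function. -/

section LocalLip

variable {X : Type*} [MetricSpace X]

/-- The distance is 1-Lipschitz and `ψ` varies no more than the differentiable `h`. Thus truncated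
profiles are controlled even at the corners of the truncation. -/
theorem localLip_comp_dist_le {x₀ x : X} {ψ h : ℝ → ℝ} {h' : ℝ}
    (hh : HasDerivAt h h' (dist x₀ x))
    (hψ : ∀ r, 0 ≤ r → |ψ r - ψ (dist x₀ x)| ≤ |h r - h (dist x₀ x)|) :
    localLip (fun y => ψ (dist x₀ y)) x ≤ ENNReal.ofReal |h'| := by
  refine ENNReal.le_of_forall_pos_le_add fun ε hε _ => ?_
  have h1 : ∀ᶠ r in 𝓝 (dist x₀ x), |h r - h (dist x₀ x)| ≤ (|h'| + ε) * |r - dist x₀ x| := by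
    filter_upwards [(hasDerivAt_iff_isLittleO.1 hh).def (NNReal.coe_pos.2 hε)] with r hr
    rw [Real.norm_eq_abs, Real.norm_eq_abs, smul_eq_mul] at hr
    calc |h r - h (dist x₀ x)| = |(h r - h (dist x₀ x) - (r - dist x₀ x) * h') +
          (r - dist x₀ x) * h'| := by ring_nf
      _ ≤ _ := abs_add_le _ _
      _ ≤ _ := by rw [abs_mul]; linarith
  have h2 : Tendsto (fun y => dist x₀ y) (𝓝[≠] x) (𝓝 (dist x₀ x)) :=
    (continuous_const.dist continuous_id).continuousAt.tendsto.mono_left nhdsWithin_le_nhds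
  refine limsup_le_of_le (h := ?_)
  filter_upwards [h2.eventually h1] with y hy
  refine ENNReal.div_le_of_le_mul ?_
  have h3 : |ψ (dist x₀ y) - ψ (dist x₀ x)| ≤ (|h'| + ε) * dist x y := by
    refine (hψ _ dist_nonneg).trans (hy.trans ?_)
    gcongr
    have := abs_dist_sub_le y x x₀
    rwa [dist_comm y x₀, dist_comm x x₀, dist_comm y x] at this
  have hε' : ENNReal.ofReal |h'| + ε = ENNReal.ofReal (|h'| + ε) := by
    rw [ENNReal.ofReal_add (abs_nonneg _) ε.coe_nonneg, ENNReal.ofReal_coe_nnreal]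
  rw [hε', edist_dist, edist_dist, Real.dist_eq, ← ENNReal.ofReal_mul (by positivity)]
  exact ENNReal.ofReal_le_ofReal h3

/-- The profile `r ↦ (l + r ^ s) ^ (-β)` of the Euclidean extremal functions. -/
noncomputable def bubble (l s β r : ℝ) : ℝ := (l + r ^ s) ^ (-β)

theorem hasDerivAt_bubble {l s β r : ℝ} (hl : 0 < l) (hr : 0 < r) :
    HasDerivAt (bubble l s β) (-(β * s * r ^ (s - 1) * (l + r ^ s) ^ (-β - 1))) r := by
  have h1 : HasDerivAt (fun r : ℝ => l + r ^ s) (s * r ^ (s - 1)) r :=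
    (Real.hasDerivAt_rpow_const (Or.inl hr.ne')).const_add l
  refine (h1.rpow_const (p := -β) (Or.inl (by positivity))).congr_deriv ?_
  ring

theorem bubble_antitoneOn {l s β : ℝ} (hl : 0 < l) (hs : 0 < s) (hβ : 0 < β) :
    AntitoneOn (bubble l s β) (Set.Ici 0) := by
  intro x (hx : 0 ≤ x) y _ hxy
  unfold bubble
  exact Real.rpow_le_rpow_of_nonpos (by positivity)
    (by gcongr) (by linarith)

theorem tendsto_bubble_atTop {l s β : ℝ} (hs : 0 < s) (hβ : 0 < β) :
    Tendsto (bubble l s β) atTop (𝓝 0) :=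
  (tendsto_rpow_neg_atTop hβ).comp (tendsto_atTop_add_const_left _ l (tendsto_rpow_atTop hs))

/-- For antitone `h`, clamping the argument amounts to clamping the value between `h R` and `h ε`, a
1-Lipschitz operation. -/
theorem abs_comp_clamp_sub_le {h : ℝ → ℝ} (hh : AntitoneOn h (Set.Ici 0)) {ε R r r' : ℝ}
    (hε : 0 ≤ ε) (hR : 0 ≤ R) (hr : 0 ≤ r) (hr' : 0 ≤ r') :
    |h (max ε (min r R)) - h (max ε (min r' R))| ≤ |h r - h r'| := by
  have e : ∀ x, 0 ≤ x → h (max ε (min x R)) = min (h ε) (max (h x) (h R)) := fun x hx => by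
    rw [hh.map_max hε (le_min hx hR), hh.map_min hx hR]
  rw [e r hr, e r' hr']
  refine (abs_min_sub_min_le_max _ _ _ _).trans ?_
  rw [sub_self, abs_zero]
  refine max_le (abs_nonneg _) ((abs_max_sub_max_le_max _ _ _ _).trans ?_)
  rw [sub_self, abs_zero]
  exact max_le le_rfl (abs_nonneg _)

theorem exists_lipschitzWith_bubble_clamp {l s β ε R : ℝ} (hl : 0 < l) (hε : 0 < ε) (hεR : ε ≤ R) :
    ∃ K, LipschitzWith K (fun r => bubble l s β (max ε (min r R))) := by
  have hcont : ContinuousOn (fun r : ℝ => -(β * s * r ^ (s - 1) * (l + r ^ s) ^ (-β - 1)))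
      (Set.Icc ε R) := by
    intro r hr
    have hr0 : 0 < r := hε.trans_le hr.1
    have h1 : 0 < l + r ^ s := by positivity
    refine ContinuousAt.continuousWithinAt ?_
    fun_prop (disch := first | exact Or.inl hr0.ne' | exact Or.inl h1.ne')
  obtain ⟨K, hK⟩ := isCompact_Icc.exists_bound_of_continuousOn hcont
  have hlip : LipschitzOnWith K.toNNReal (bubble l s β) (Set.Icc ε R) := by
    refine (convex_Icc ε R).lipschitzOnWith_of_nnnorm_hasDerivWithin_le
      (fun r hr => (hasDerivAt_bubble hl (hε.trans_le hr.1)).hasDerivWithinAt) fun r hr => ?_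
    rw [← NNReal.coe_le_coe, coe_nnnorm]
    exact (hK r hr).trans (Real.le_coe_toNNReal K)
  refine ⟨K.toNNReal * 1, lipschitzOnWith_univ.1 (hlip.comp (g := bubble l s β) ?_ ?_)⟩
  · exact (LipschitzWith.const_max (LipschitzWith.id.min_const R) ε).lipschitzOnWith
  · exact fun r _ => ⟨le_max_left _ _, max_le hεR (min_le_right _ _)⟩

variable [ProperSpace X]

theorem isLipZero_bubble_clamp (x₀ : X) {l s β ε R : ℝ} (hl : 0 < l) (hε : 0 < ε) (hεR : ε ≤ R) :
    IsLipZero (fun x => bubble l s β (max ε (min (dist x₀ x) R)) - bubble l s β R) := by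
  obtain ⟨K, hK⟩ := exists_lipschitzWith_bubble_clamp (β := β) (s := s) hl hε hεR
  refine ⟨⟨K * 1 + 0, ((hK.comp (LipschitzWith.dist_right x₀)).sub (LipschitzWith.const _))⟩, ?_⟩
  refine HasCompactSupport.intro (isCompact_closedBall x₀ R) fun x hx => ?_
  rw [Metric.mem_closedBall, not_le, dist_comm] at hx
  rw [min_eq_right hx.le, max_eq_right hεR, sub_self]

variable [MeasurableSpace X] [BorelSpace X]

/-- The inequality for the extremal profile, which is not itself an admissible test function. -/
theorem SatisfiesCKN.bubble_le {μ : Measure X} {n : ℕ} {a C : ℝ} {x₀ : X}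
    (hCKN : SatisfiesCKN μ n a x₀ C) (hp : 0 < cknExponent n a) (hx₀ : μ {x₀} = 0)
    {l s β : ℝ} (hl : 0 < l) (hs : 0 < s) (hβ : 0 < β) :
    (∫⁻ x, ‖bubble l s β (dist x₀ x)‖ₑ ^ cknExponent n a /
        edist x₀ x ^ (a * cknExponent n a) ∂μ) ^ (1 / cknExponent n a) ≤
      ENNReal.ofReal C * (∫⁻ x, ENNReal.ofReal
        (β * s * dist x₀ x ^ (s - 1) * (l + dist x₀ x ^ s) ^ (-β - 1)) ^ (2 : ℝ) ∂μ) ^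
          ((1 : ℝ) / 2) := by
  set p := cknExponent n a
  have hne : ∀ᵐ x ∂μ, x ≠ x₀ := by
    rw [ae_iff]; simpa using hx₀
  -- The upper clamp and the subtraction give compact support. The lower clamp is needed because `r
  -- ^ s` fails to be Lipschitz at `0` when `s < 1`.
  let u : ℕ → X → ℝ := fun k x =>
    bubble l s β (max (1 / ((k : ℝ) + 1)) (min (dist x₀ x) (k + 1))) - bubble l s β (k + 1)
  have hkR : ∀ k : ℕ, 1 / ((k : ℝ) + 1) ≤ k + 1 := fun k => by
    have : (1 : ℝ) ≤ k + 1 := by linarith [k.cast_nonneg (α := ℝ)]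
    exact (div_le_one (by positivity)).2 this |>.trans this
  have hu : ∀ k, IsLipZero (u k) := fun k => isLipZero_bubble_clamp x₀ hl (by positivity) (hkR k)
  have hgrad : ∀ k, ∫⁻ x, localLip (u k) x ^ (2 : ℝ) ∂μ ≤ ∫⁻ x, ENNReal.ofReal
      (β * s * dist x₀ x ^ (s - 1) * (l + dist x₀ x ^ s) ^ (-β - 1)) ^ (2 : ℝ) ∂μ := by
    intro k
    refine lintegral_mono_ae ?_
    filter_upwards [hne] with x hx
    have hd : 0 < dist x₀ x := dist_pos.2 hx.symm
    refine ENNReal.rpow_le_rpow ?_ (by norm_num)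
    refine (localLip_comp_dist_le (h := bubble l s β) (ψ := fun r => bubble l s β
      (max (1 / ((k : ℝ) + 1)) (min r (k + 1))) - bubble l s β (k + 1))
      (hasDerivAt_bubble hl hd) fun r hr => ?_).trans ?_
    · rw [sub_sub_sub_cancel_right]
      exact abs_comp_clamp_sub_le (bubble_antitoneOn hl hs hβ) (by positivity) (by positivity) hr
        hd.le
    · rw [abs_neg, abs_of_nonneg (by positivity)]
  have hbound : ∀ k, ∫⁻ x, ‖u k x‖ₑ ^ p / edist x₀ x ^ (a * p) ∂μ ≤
      (ENNReal.ofReal C * (∫⁻ x, ENNReal.ofReal (β * s * dist x₀ x ^ (s - 1) *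
        (l + dist x₀ x ^ s) ^ (-β - 1)) ^ (2 : ℝ) ∂μ) ^ ((1 : ℝ) / 2)) ^ p := by
    intro k
    rw [← ENNReal.rpow_inv_le_iff hp, ← one_div]
    refine (hCKN _ (hu k)).trans ?_
    exact mul_le_mul' le_rfl (ENNReal.rpow_le_rpow (hgrad k) (by norm_num))
  have hmeas : ∀ k, Measurable fun x => ‖u k x‖ₑ ^ p / edist x₀ x ^ (a * p) := by
    intro k
    have : Measurable (u k) := (hu k).1.choose_spec.continuous.measurable
    fun_prop
  rw [one_div, ENNReal.rpow_inv_le_iff hp]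
  calc
    -- Fatou on the left-hand side; the gradients of the truncations are already bounded by the full
    -- gradient.
    _ ≤ ∫⁻ x, liminf (fun k => ‖u k x‖ₑ ^ p / edist x₀ x ^ (a * p)) atTop ∂μ := by
      refine lintegral_mono_ae ?_
      filter_upwards [hne] with x hx
      have hd : 0 < dist x₀ x := dist_pos.2 hx.symm
      have hk : Tendsto (fun k : ℕ => (k : ℝ) + 1) atTop atTop :=
        tendsto_atTop_add_const_right _ _ tendsto_natCast_atTop_atTop
      have h1 : Tendsto (fun k => u k x) atTop (𝓝 (bubble l s β (dist x₀ x) - 0)) := by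
        refine Tendsto.sub ?_ ((tendsto_bubble_atTop hs hβ).comp hk)
        refine tendsto_const_nhds.congr' ?_
        filter_upwards [tendsto_one_div_add_atTop_nhds_zero_nat.eventually_lt_const hd,
          hk.eventually_gt_atTop (dist x₀ x)] with k hk1 hk2
        rw [min_eq_left hk2.le, max_eq_right hk1.le]
      rw [sub_zero] at h1
      have h2 : Tendsto (fun k => ‖u k x‖ₑ ^ p / edist x₀ x ^ (a * p)) atTop
          (𝓝 (‖bubble l s β (dist x₀ x)‖ₑ ^ p / edist x₀ x ^ (a * p))) := by
        refine ENNReal.Tendsto.div_const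
          ((ENNReal.continuous_rpow_const.tendsto _).comp h1.enorm) (Or.inr ?_)
        rw [edist_dist]
        exact (ENNReal.rpow_pos (ENNReal.ofReal_pos.2 hd) ENNReal.ofReal_ne_top).ne'
      exact h2.liminf_eq.ge
    _ ≤ liminf (fun k => ∫⁻ x, ‖u k x‖ₑ ^ p / edist x₀ x ^ (a * p) ∂μ) atTop :=
      lintegral_liminf_le hmeas
    _ ≤ liminf (fun _ : ℕ => (ENNReal.ofReal C * (∫⁻ x, ENNReal.ofReal (β * s *
          dist x₀ x ^ (s - 1) * (l + dist x₀ x ^ s) ^ (-β - 1)) ^ (2 : ℝ) ∂μ) ^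
            ((1 : ℝ) / 2)) ^ p) atTop :=
      liminf_le_liminf (Eventually.of_forall hbound)
    _ = _ := liminf_const _

end LocalLip

/-! ### Volume ratios under doubling and (AR). -/

theorem unitBallVolume_pos (n : ℕ) : 0 < unitBallVolume n :=
  div_pos (Real.rpow_pos_of_pos Real.pi_pos _) (Real.Gamma_pos_of_pos (by positivity))

theorem euclideanBallVolume_eq {n : ℕ} (hn : n ≠ 0) {r : ℝ} (hr : 0 ≤ r) :
    euclideanBallVolume n r = ENNReal.ofReal (unitBallVolume n * r ^ n) := by
  have : Nonempty (Fin n) := ⟨⟨0, Nat.pos_of_ne_zero hn⟩⟩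
  rw [euclideanBallVolume, EuclideanSpace.volume_ball, Fintype.card_fin, ← ENNReal.ofReal_pow hr,
    ← ENNReal.ofReal_mul (by positivity), mul_comm, unitBallVolume, Real.sqrt_eq_rpow,
    ← Real.rpow_mul_natCast Real.pi_pos.le, one_div_mul_eq_div]

section Growth

variable {X : Type*} [MetricSpace X] [MeasurableSpace X] {μ : Measure X}

theorem PosFiniteOnBoundedOpen.ball (hμ : PosFiniteOnBoundedOpen μ) (x : X) {r : ℝ} (hr : 0 < r) :
    0 < μ (Metric.ball x r) ∧ μ (Metric.ball x r) < ∞ :=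
  hμ _ Metric.isOpen_ball Metric.isBounded_ball ⟨x, Metric.mem_ball_self hr⟩

theorem PosFiniteOnBoundedOpen.isLocallyFiniteMeasure (hμ : PosFiniteOnBoundedOpen μ) :
    IsLocallyFiniteMeasure μ :=
  ⟨fun x => ⟨Metric.ball x 1, Metric.ball_mem_nhds x one_pos, (hμ.ball x one_pos).2⟩⟩

theorem SatisfiesVD.measure_ball_le (hμ : PosFiniteOnBoundedOpen μ) {n : ℕ} {C₀ : ℝ}
    (hVD : SatisfiesVD μ n C₀) (x : X) {r R : ℝ} (hr : 0 < r) (hrR : r < R) :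
    μ (Metric.ball x R) ≤ ENNReal.ofReal (C₀ * (R / r) ^ n) * μ (Metric.ball x r) := by
  have h := hμ.ball x hr
  rw [← ENNReal.div_le_iff h.1.ne' h.2.ne]
  exact hVD x r R hr hrR

/-- The volume of the ball of radius `r` about `x₀`, relative to the Euclidean one. -/
noncomputable def volumeRatio (μ : Measure X) (n : ℕ) (x₀ : X) (r : ℝ) : ℝ≥0∞ :=
  μ (Metric.ball x₀ r) / euclideanBallVolume n r

theorem measurable_volumeRatio (μ : Measure X) (n : ℕ) (x₀ : X) :
    Measurable (volumeRatio μ n x₀) := by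
  have h1 : Monotone fun r => μ (Metric.ball x₀ r) := fun _ _ h =>
    measure_mono (Metric.ball_subset_ball h)
  have h2 : Monotone fun r => euclideanBallVolume n r := fun _ _ h =>
    measure_mono (Metric.ball_subset_ball h)
  exact h1.measurable.div h2.measurable

/-- If the bound failed at `ρ`, the quotient of the two sides would exceed the lower limit `1`, so
some `r < ρ` would have a smaller volume ratio; doubling from `r` to `ρ` contradicts this. -/
theorem measure_ball_le_of_VD_of_AR (hμ : PosFiniteOnBoundedOpen μ) {n : ℕ} (hn : n ≠ 0)
    {C₀ : ℝ} (hC₀ : 1 ≤ C₀) {x₀ : X} (hVD : SatisfiesVD μ n C₀) (hAR : SatisfiesAR μ n x₀)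
    {ρ : ℝ} (hρ : 0 < ρ) :
    μ (Metric.ball x₀ ρ) ≤ ENNReal.ofReal (C₀ * unitBallVolume n * ρ ^ n) := by
  have hω := unitBallVolume_pos n
  by_contra! hlt
  set K := ENNReal.ofReal (C₀ * unitBallVolume n * ρ ^ n) with hK
  have hK0 : K ≠ 0 := (ENNReal.ofReal_pos.2 (by positivity)).ne'
  have hKt : K ≠ ∞ := ENNReal.ofReal_ne_top
  have h1 : liminf (fun r : ℝ => μ (Metric.ball x₀ r) / euclideanBallVolume n r) (𝓝[>] (0 : ℝ)) <
      μ (Metric.ball x₀ ρ) / K := by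
    rw [SatisfiesAR] at hAR
    rw [hAR, ENNReal.lt_div_iff_mul_lt (Or.inl hK0) (Or.inl hKt), one_mul]
    exact hlt
  obtain ⟨r, hr, hr0, hrρ⟩ := ((frequently_lt_of_liminf_lt (by isBoundedDefault) h1).and_eventually
    (Ioo_mem_nhdsGT hρ)).exists
  have hE := euclideanBallVolume_eq hn hr0.le
  have hE0 : euclideanBallVolume n r ≠ 0 := hE ▸ (ENNReal.ofReal_pos.2 (by positivity)).ne'
  have hEt : euclideanBallVolume n r ≠ ∞ := hE ▸ ENNReal.ofReal_ne_top
  have h2 : μ (Metric.ball x₀ r) < μ (Metric.ball x₀ ρ) / K * euclideanBallVolume n r :=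
    (ENNReal.div_lt_iff (Or.inl hE0) (Or.inl hEt)).1 hr
  have h3 := hVD.measure_ball_le hμ x₀ hr0 hrρ
  have hc : ENNReal.ofReal (C₀ * (ρ / r) ^ n) ≠ 0 := (ENNReal.ofReal_pos.2 (by positivity)).ne'
  have h4 : μ (Metric.ball x₀ ρ) < ENNReal.ofReal (C₀ * (ρ / r) ^ n) *
      (μ (Metric.ball x₀ ρ) / K * euclideanBallVolume n r) :=
    h3.trans_lt ((ENNReal.mul_lt_mul_iff_right hc ENNReal.ofReal_ne_top).2 h2)
  have h5 : ENNReal.ofReal (C₀ * (ρ / r) ^ n) * euclideanBallVolume n r = K := by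
    rw [hE, hK, ← ENNReal.ofReal_mul (by positivity)]
    congr 1
    rw [div_pow]
    field_simp
  rw [mul_left_comm, h5, ENNReal.div_mul_cancel hK0 hKt] at h4
  exact lt_irrefl _ h4

theorem measure_singleton_eq_zero_of_VD_of_AR (hμ : PosFiniteOnBoundedOpen μ) {n : ℕ}
    (hn : n ≠ 0) {C₀ : ℝ} (hC₀ : 1 ≤ C₀) {x₀ : X} (hVD : SatisfiesVD μ n C₀)
    (hAR : SatisfiesAR μ n x₀) : μ {x₀} = 0 := by
  have h1 : Tendsto (fun ρ : ℝ => ENNReal.ofReal (C₀ * unitBallVolume n * ρ ^ n)) (𝓝[>] 0)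
      (𝓝 (ENNReal.ofReal (C₀ * unitBallVolume n * 0 ^ n))) :=
    (ENNReal.continuous_ofReal.comp (by fun_prop)).continuousAt.tendsto.mono_left
      nhdsWithin_le_nhds
  rw [zero_pow hn, mul_zero, ENNReal.ofReal_zero] at h1
  refine le_antisymm (ge_of_tendsto h1 ?_) zero_le
  filter_upwards [self_mem_nhdsWithin] with ρ hρ
  exact (measure_mono (Set.singleton_subset_iff.2 (Metric.mem_ball_self hρ))).trans
    (measure_ball_le_of_VD_of_AR hμ hn hC₀ hVD hAR hρ)

theorem volumeRatio_le (hμ : PosFiniteOnBoundedOpen μ) {n : ℕ} (hn : n ≠ 0)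
    {C₀ : ℝ} (hC₀ : 1 ≤ C₀) {x₀ : X} (hVD : SatisfiesVD μ n C₀) (hAR : SatisfiesAR μ n x₀)
    {r : ℝ} (hr : 0 < r) : volumeRatio μ n x₀ r ≤ ENNReal.ofReal C₀ := by
  have hω := unitBallVolume_pos n
  refine ENNReal.div_le_of_le_mul ((measure_ball_le_of_VD_of_AR hμ hn hC₀ hVD hAR hr).trans ?_)
  rw [euclideanBallVolume_eq hn hr.le, ← ENNReal.ofReal_mul (by positivity), mul_assoc]

/-- `B(x₀, R)` lies in `B(x, R + d(x₀, x))`, and doubling descends from there to `B(x, ρ)`. The last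
factor tends to `1` as `R → ∞`, so the centre does not matter in the limit. -/
theorem volumeRatio_le_mul (hμ : PosFiniteOnBoundedOpen μ) {n : ℕ} (hn : n ≠ 0)
    {C₀ : ℝ} (hC₀ : 1 ≤ C₀) (x₀ : X) (hVD : SatisfiesVD μ n C₀) (x : X) {ρ R : ℝ} (hρ : 0 < ρ)
    (hρR : ρ < R) :
    volumeRatio μ n x₀ R ≤ ENNReal.ofReal (C₀ / (unitBallVolume n * ρ ^ n)) *
      μ (Metric.ball x ρ) * ENNReal.ofReal ((1 + dist x₀ x / R) ^ n) := by
  have hω := unitBallVolume_pos n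
  have hR : 0 < R := hρ.trans hρR
  have hsub : Metric.ball x₀ R ⊆ Metric.ball x (R + dist x₀ x) := by
    intro y hy
    rw [Metric.mem_ball] at hy ⊢
    linarith [dist_triangle y x₀ x]
  refine ENNReal.div_le_of_le_mul (((measure_mono hsub).trans (hVD.measure_ball_le hμ x hρ
    (by linarith [dist_nonneg (x := x₀) (y := x)]))).trans_eq ?_)
  rw [euclideanBallVolume_eq hn hR.le, mul_right_comm (ENNReal.ofReal _), mul_right_comm,
    ← ENNReal.ofReal_mul (by positivity), ← ENNReal.ofReal_mul (by positivity)]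
  congr 2
  rw [show 1 + dist x₀ x / R = (R + dist x₀ x) / R by field_simp, div_pow, div_pow]
  field_simp

variable [BorelSpace X] [ProperSpace X]

-- The sublevel sets of `W` are balls about `x₀`. Since `(m + γ) s = n`, Euclidean volume at radius
-- `(l t) ^ (1/s)` scales as `(l t) ^ (m + γ)`, and all powers of `l` cancel.
open Set in
theorem lintegral_dist_radialProfile (hμ : PosFiniteOnBoundedOpen μ) {n : ℕ} (hn : n ≠ 0)
    {x₀ : X} (hx₀ : μ {x₀} = 0) {s γ m l : ℝ} (hs : 0 < s) (hγ : 0 ≤ γ) (hm : 1 < m)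
    (hnm : (m + γ) * s = n) (hl : 0 < l) :
    ENNReal.ofReal (l ^ (m - 1)) * ∫⁻ x, ENNReal.ofReal
        ((dist x₀ x ^ s) ^ (-γ) * (l + dist x₀ x ^ s) ^ (1 - 2 * m)) ∂μ =
      ∫⁻ t in Ioi (0 : ℝ), ENNReal.ofReal (unitBallVolume n) *
        ENNReal.ofReal (radialKernel γ m t * t ^ (m + γ)) *
          volumeRatio μ n x₀ ((l * t) ^ (1 / s)) := by
  have hω := unitBallVolume_pos n
  have := hμ.isLocallyFiniteMeasure
  have hpos : ∀ᵐ x ∂μ, 0 < dist x₀ x ^ s := by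
    have hne : ∀ᵐ x ∂μ, x ≠ x₀ := by rw [ae_iff]; simpa using hx₀
    filter_upwards [hne] with x hx
    exact Real.rpow_pos_of_pos (dist_pos.2 hx.symm) _
  rw [lintegral_radialProfile (by fun_prop) hpos hγ hm hl,
    ← lintegral_const_mul' _ _ ENNReal.ofReal_ne_top]
  refine setLIntegral_congr_fun measurableSet_Ioi fun t (ht : 0 < t) => ?_
  have hlt : 0 < l * t := by positivity
  have hball : {x | dist x₀ x ^ s < l * t} = Metric.ball x₀ ((l * t) ^ (1 / s)) := by
    ext x
    rw [mem_ofPred_eq, Metric.mem_ball, dist_comm x, one_div,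
      Real.lt_rpow_inv_iff_of_pos dist_nonneg hlt.le hs]
  have hpow : ((l * t) ^ (1 / s)) ^ n = (l * t) ^ (m + γ) := by
    rw [← Real.rpow_mul_natCast hlt.le, ← hnm]
    congr 1
    field_simp
  have hk := radialKernel_nonneg hγ hm ht
  rw [hball, volumeRatio, euclideanBallVolume_eq hn (by positivity), hpow]
  generalize μ (Metric.ball x₀ ((l * t) ^ (1 / s))) = v
  rw [← mul_assoc, ← mul_assoc, div_eq_mul_inv, ← ENNReal.ofReal_inv_of_pos (by positivity), mul_comm v _,
    ← mul_assoc, ← ENNReal.ofReal_mul (by positivity), ← ENNReal.ofReal_mul (by positivity),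
    ← ENNReal.ofReal_mul (by positivity), ← ENNReal.ofReal_mul (by positivity)]
  congr 2
  have e : l ^ (m - 1) * l ^ (1 - 2 * m - γ) = (l ^ (m + γ))⁻¹ := by
    rw [← Real.rpow_add hl, ← Real.rpow_neg hl.le]; congr 1; ring
  rw [mul_right_comm, e, Real.mul_rpow hl.le ht.le]
  have h1 := (Real.rpow_pos_of_pos hl (m + γ)).ne'
  have h2 := (Real.rpow_pos_of_pos ht (m + γ)).ne'
  field_simp

end Growth

/-! ### Arithmetic of the exponents and the sharp constant. -/

section Exponents

variable {n : ℕ} {a : ℝ}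

theorem cknExponent_pos (hn : 3 ≤ n) (ha0 : 0 ≤ a) : 0 < cknExponent n a := by
  have hn' : (3 : ℝ) ≤ n := by exact_mod_cast hn
  exact div_pos (by linarith) (by linarith)

theorem two_sub_mul_cknExponent (hn : 3 ≤ n) (ha0 : 0 ≤ a) :
    2 - a * cknExponent n a = 2 * (n - 2) * (1 - a) / (n - 2 + 2 * a) := by
  have hn' : (3 : ℝ) ≤ n := by exact_mod_cast hn
  have : (n : ℝ) - 2 + 2 * a ≠ 0 := by linarith
  rw [cknExponent]
  field_simp
  ring

theorem two_sub_mul_cknExponent_pos (hn : 3 ≤ n) (ha0 : 0 ≤ a) (ha1 : a < 1) :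
    0 < 2 - a * cknExponent n a := by
  have hn' : (3 : ℝ) ≤ n := by exact_mod_cast hn
  rw [two_sub_mul_cknExponent hn ha0]
  exact div_pos (mul_pos (by linarith) (by linarith)) (by linarith)

theorem one_lt_div_two_mul_one_sub (hn : 3 ≤ n) (ha0 : 0 ≤ a) (ha1 : a < 1) :
    1 < (n : ℝ) / (2 * (1 - a)) := by
  have hn' : (3 : ℝ) ≤ n := by exact_mod_cast hn
  rw [one_lt_div (by linarith)]
  linarith

/-- This product is the constant in the radial derivative of the profile `(l + r ^ s) ^ (1 - m)`,
whence the factor `(n - 2)²`. -/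
theorem sub_one_mul_two_sub (hn : 3 ≤ n) (ha0 : 0 ≤ a) (ha1 : a < 1) :
    ((n : ℝ) / (2 * (1 - a)) - 1) * (2 - a * cknExponent n a) = n - 2 := by
  have hn' : (3 : ℝ) ≤ n := by exact_mod_cast hn
  have h1 : (n : ℝ) - 2 + 2 * a ≠ 0 := by linarith
  have h2 : 1 - a ≠ 0 := by linarith
  rw [two_sub_mul_cknExponent hn ha0]
  field_simp
  ring

/-- Makes the `p`-th power of the profile equal to `(l + r ^ s) ^ (-2m)`, the power also found in
the squared gradient. -/
theorem sub_one_mul_cknExponent (hn : 3 ≤ n) (ha0 : 0 ≤ a) (ha1 : a < 1) :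
    ((n : ℝ) / (2 * (1 - a)) - 1) * cknExponent n a = 2 * (n / (2 * (1 - a))) := by
  have hn' : (3 : ℝ) ≤ n := by exact_mod_cast hn
  have h1 : (n : ℝ) - 2 + 2 * a ≠ 0 := by linarith
  have h2 : 1 - a ≠ 0 := by linarith
  rw [cknExponent]
  field_simp
  ring

theorem cknConstant_pos (hn : 3 ≤ n) (ha0 : 0 ≤ a) (ha1 : a < 1) : 0 < cknConstant n a := by
  have hn' : (3 : ℝ) ≤ n := by exact_mod_cast hn
  have hs := two_sub_mul_cknExponent_pos hn ha0 ha1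
  have hω := unitBallVolume_pos n
  have h1 : 0 < (n : ℝ) - a * cknExponent n a := by linarith
  have h2 : 0 < (n : ℝ) - 2 := by linarith
  have hG1 := Real.Gamma_pos_of_pos (div_pos h1 hs)
  have hG2 : 0 < Real.Gamma ((2 * n - 2 * (a * cknExponent n a)) / (2 - a * cknExponent n a)) :=
    Real.Gamma_pos_of_pos (div_pos (by linarith) hs)
  unfold cknConstant
  positivity

/-- The normalized moment `l ^ (m - 1) * ∫ |x| ^ (-ap) (l + |x| ^ (2 - ap)) ^ (1 - 2m) dx` of
Lebesgue measure on `ℝⁿ`, where `m = n / (2 (1 - a))`. It does not depend on `l`. -/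
noncomputable def euclideanMoment (n : ℕ) (a : ℝ) : ℝ :=
  let m := (n : ℝ) / (2 * (1 - a))
  unitBallVolume n * ((m + a * cknExponent n a / (2 - a * cknExponent n a)) *
    (Real.Gamma m * Real.Gamma (m - 1) / Real.Gamma (2 * m - 1)))

theorem euclideanMoment_pos (hn : 3 ≤ n) (ha0 : 0 ≤ a) (ha1 : a < 1) :
    0 < euclideanMoment n a := by
  have hs := two_sub_mul_cknExponent_pos hn ha0 ha1
  have hω := unitBallVolume_pos n
  have hp := cknExponent_pos hn ha0
  have hm := one_lt_div_two_mul_one_sub hn ha0 ha1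
  unfold euclideanMoment
  set m := (n : ℝ) / (2 * (1 - a))
  have hG1 := Real.Gamma_pos_of_pos (show 0 < m by linarith)
  have hG2 := Real.Gamma_pos_of_pos (show 0 < m - 1 by linarith)
  have hG3 := Real.Gamma_pos_of_pos (show 0 < 2 * m - 1 by linarith)
  positivity

/-- The sharpness of `cknConstant`: Lebesgue measure scaled by `(K_a / C) ^ (n / (1 - a))` is
critical for the constant `C`. -/
theorem critical_identity (hn : 3 ≤ n) (ha0 : 0 ≤ a) (ha1 : a < 1) {m C : ℝ}
    (hmdef : m = (n : ℝ) / (2 * (1 - a))) (hC : 0 < C) :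
    ((m - 1) / (2 * m - 1)) ^ (1 - 1 / m) = C ^ 2 * ((n : ℝ) - 2) ^ 2 * (m / (2 * m - 1)) *
      ((C⁻¹ * cknConstant n a) ^ ((n : ℝ) / (1 - a)) * euclideanMoment n a) ^ (1 / m) := by
  have hn' : (3 : ℝ) ≤ n := by exact_mod_cast hn
  have hs := two_sub_mul_cknExponent_pos hn ha0 ha1
  have hω := unitBallVolume_pos n
  have hp := cknExponent_pos hn ha0
  have hm := one_lt_div_two_mul_one_sub hn ha0 ha1
  have hms := sub_one_mul_two_sub hn ha0 ha1
  have hK := cknConstant_pos hn ha0 ha1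
  have hD := euclideanMoment_pos hn ha0 ha1
  have ha1' : 1 - a ≠ 0 := by linarith
  have h2m : (n : ℝ) / (1 - a) = 2 * m := by rw [hmdef]; field_simp
  rw [← hmdef] at hm hms
  have hm0 : 0 < m := by linarith
  have h21 : 0 < 2 * m - 1 := by linarith
  have hm1 : 0 < m - 1 := by linarith
  have hG1 := Real.Gamma_pos_of_pos hm1
  have hG3 := Real.Gamma_pos_of_pos h21
  set s := 2 - a * cknExponent n a with hsdef
  have hθ : a * cknExponent n a = 2 - s := by rw [hsdef]; ring
  have hmsn : m * s = n - a * cknExponent n a := by linarith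
  have hnθ : 0 < (n : ℝ) - a * cknExponent n a := hmsn ▸ mul_pos hm0 hs
  have hΓm : Real.Gamma m = (m - 1) * Real.Gamma (m - 1) := by
    rw [← Real.Gamma_add_one hm1.ne', sub_add_cancel]
  have hΓ2m : Real.Gamma (2 * m) = (2 * m - 1) * Real.Gamma (2 * m - 1) := by
    rw [← Real.Gamma_add_one h21.ne', sub_add_cancel]
  set Q := s * Real.Gamma (2 * m) / (n * unitBallVolume n * Real.Gamma m ^ 2) with hQ
  have hQ0 : 0 < Q := by
    rw [hQ, hΓm, hΓ2m]
    have : (0 : ℝ) < n := by linarith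
    positivity
  have hKsq : cknConstant n a ^ 2 =
      1 / ((n - 2) * (n - a * cknExponent n a)) * Q ^ (1 / m) := by
    have e1 : (2 * (n : ℝ) - 2 * (a * cknExponent n a)) / s = 2 * m := by
      rw [div_eq_iff hs.ne']; linarith
    have e2 : ((n : ℝ) - a * cknExponent n a) / s = m := by
      rw [div_eq_iff hs.ne', hmsn]
    have e3 : s / (2 * (n : ℝ) - 2 * (a * cknExponent n a)) = 1 / (2 * m) := by
      rw [← e1, one_div_div]
    have h0 : 0 ≤ 1 / (((n : ℝ) - 2) * (n - a * cknExponent n a)) :=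
      one_div_nonneg.2 (mul_nonneg (by linarith) hnθ.le)
    simp only [cknConstant]
    rw [← hsdef, e1, e2, e3, mul_pow, ← Real.rpow_mul_natCast h0, ← Real.rpow_mul_natCast hQ0.le,
      show (1 : ℝ) / 2 * (2 : ℕ) = 1 by norm_num, Real.rpow_one]
    congr 2
    push_cast
    field_simp
  -- The Gamma factors in `K_a` are those of the Euclidean moment inverted, so only the rational
  -- factor `(m - 1) / (2m - 1)` survives.
  have hQD : Q * euclideanMoment n a = ((m - 1) / (2 * m - 1))⁻¹ := by
    have e : m + a * cknExponent n a / s = n / s := by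
      rw [eq_div_iff hs.ne', add_mul, hmsn, div_mul_cancel₀ _ hs.ne']; ring
    simp only [euclideanMoment]
    rw [← hmdef, ← hsdef, e, hQ, hΓ2m, hΓm]
    generalize Real.Gamma (2 * m - 1) = G at hG3 ⊢
    generalize Real.Gamma (m - 1) = G' at hG1 ⊢
    generalize 2 * m - 1 = d at h21 ⊢
    generalize m - 1 = d' at hm1 ⊢
    have : (n : ℝ) ≠ 0 := by linarith
    field_simp
  have hb : ((C⁻¹ * cknConstant n a) ^ ((n : ℝ) / (1 - a))) ^ (1 / m) =
      (C⁻¹ * cknConstant n a) ^ 2 := by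
    rw [← Real.rpow_mul (by positivity), ← Real.rpow_natCast, h2m]
    congr 1
    push_cast
    field_simp
  have hκ : 0 < (m - 1) / (2 * m - 1) := by positivity
  rw [Real.mul_rpow (by positivity) hD.le, hb, mul_pow, hKsq]
  have e4 : (n : ℝ) - a * cknExponent n a = m * s := hmsn.symm
  have hn2 : (n : ℝ) - 2 = (m - 1) * s := hms.symm
  calc _ = (m - 1) / (2 * m - 1) * (((m - 1) / (2 * m - 1))⁻¹) ^ (1 / m) := by
        rw [Real.rpow_sub hκ, Real.rpow_one, Real.inv_rpow hκ.le, div_eq_mul_inv]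
    _ = (m - 1) / (2 * m - 1) * (Q ^ (1 / m) * euclideanMoment n a ^ (1 / m)) := by
        rw [← hQD, Real.mul_rpow hQ0.le hD.le]
    _ = _ := by
        rw [e4, hn2]
        generalize 2 * m - 1 = d at h21 ⊢
        generalize m - 1 = d' at hm1 ⊢
        field_simp

end Exponents

/-! ### CKN as an inequality between moments. -/

section Moments

variable {X : Type*} [MetricSpace X] [ProperSpace X] [MeasurableSpace X] [BorelSpace X]
  {μ : Measure X} {n : ℕ} {a C : ℝ} {x₀ : X}

theorem SatisfiesCKN.lintegral_moment_le (hCKN : SatisfiesCKN μ n a x₀ C) (hn : 3 ≤ n)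
    (ha0 : 0 ≤ a) (ha1 : a < 1) (hx₀ : μ {x₀} = 0) {s m γ l : ℝ}
    (hsdef : s = 2 - a * cknExponent n a) (hmdef : m = (n : ℝ) / (2 * (1 - a)))
    (hγdef : γ = a * cknExponent n a / s) (hl : 0 < l) :
    (∫⁻ x, ENNReal.ofReal ((dist x₀ x ^ s) ^ (-γ) * (l + dist x₀ x ^ s) ^ (-(2 * m))) ∂μ) ^
        (1 / cknExponent n a) ≤
      ENNReal.ofReal C * (ENNReal.ofReal (((n : ℝ) - 2) ^ 2) * ∫⁻ x, ENNReal.ofReal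
        ((dist x₀ x ^ s) ^ (1 - γ) * (l + dist x₀ x ^ s) ^ (-(2 * m))) ∂μ) ^ ((1 : ℝ) / 2) := by
  have hp := cknExponent_pos hn ha0
  have hs := two_sub_mul_cknExponent_pos hn ha0 ha1
  have hm := one_lt_div_two_mul_one_sub hn ha0 ha1
  have hms := sub_one_mul_two_sub hn ha0 ha1
  have hmp := sub_one_mul_cknExponent hn ha0 ha1
  rw [← hsdef] at hs hms
  rw [← hmdef] at hm hms hmp
  have hne : ∀ᵐ x ∂μ, x ≠ x₀ := by rw [ae_iff]; simpa using hx₀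
  have hsγ : s * γ = a * cknExponent n a := by rw [hγdef]; field_simp
  convert hCKN.bubble_le hp hx₀ hl hs (sub_pos.2 hm) using 2
  · refine lintegral_congr_ae ?_
    filter_upwards [hne] with x hx
    have hd : 0 < dist x₀ x := dist_pos.2 hx.symm
    have hb : 0 < bubble l s (m - 1) (dist x₀ x) := by unfold bubble; positivity
    rw [Real.enorm_eq_ofReal hb.le, edist_dist, ENNReal.ofReal_rpow_of_pos hb,
      ENNReal.ofReal_rpow_of_pos hd, ← ENNReal.ofReal_div_of_pos (by positivity)]
    congr 1
    rw [bubble, ← Real.rpow_mul hd.le, ← Real.rpow_mul (x := l + dist x₀ x ^ s) (by positivity), neg_mul, hmp, mul_neg, hsγ,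
      Real.rpow_neg hd.le]
    ring
  · rw [← lintegral_const_mul' _ _ ENNReal.ofReal_ne_top]
    congr 1
    refine lintegral_congr_ae ?_
    filter_upwards [hne] with x hx
    have hd : 0 < dist x₀ x := dist_pos.2 hx.symm
    rw [← ENNReal.ofReal_mul (by positivity), ENNReal.ofReal_rpow_of_nonneg _ (by norm_num)]
    · congr 1
      rw [hms, Real.rpow_two, mul_pow, mul_pow, ← Real.rpow_mul_natCast hd.le,
        ← Real.rpow_mul_natCast (x := l + dist x₀ x ^ s) (by positivity), ← Real.rpow_mul hd.le,
        mul_assoc]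
      congr 3
      · push_cast; linarith
      · push_cast; ring
    · have : 0 ≤ m - 1 := by linarith
      positivity

end Moments

/-! ### The limits `l → 0` and `l → ∞`. -/

section Comparison

variable {X : Type*} [MetricSpace X] [MeasurableSpace X]
  {μ : Measure X} {n : ℕ} {a C C₀ : ℝ} {x₀ : X}

/-- The integrand of the moment `F l` of `μ`. -/
noncomputable def momentIntegrand (n : ℕ) (a : ℝ) (x₀ : X) (l : ℝ) (x : X) : ℝ :=
  (dist x₀ x ^ (2 - a * cknExponent n a)) ^
      (-(a * cknExponent n a / (2 - a * cknExponent n a))) *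
    (l + dist x₀ x ^ (2 - a * cknExponent n a)) ^ (1 - 2 * ((n : ℝ) / (2 * (1 - a))))

/-- The density against which the volume ratio is averaged in the layer-cake formula. -/
noncomputable def ratioWeight (n : ℕ) (a t : ℝ) : ℝ≥0∞ :=
  ENNReal.ofReal (unitBallVolume n) * ENNReal.ofReal
    (radialKernel (a * cknExponent n a / (2 - a * cknExponent n a)) ((n : ℝ) / (2 * (1 - a))) t *
      t ^ ((n : ℝ) / (2 * (1 - a)) + a * cknExponent n a / (2 - a * cknExponent n a)))

@[fun_prop]
theorem measurable_ratioWeight (n : ℕ) (a : ℝ) : Measurable (ratioWeight n a) := by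
  unfold ratioWeight
  fun_prop

theorem weightExponent_nonneg (hn : 3 ≤ n) (ha0 : 0 ≤ a) (ha1 : a < 1) :
    0 ≤ a * cknExponent n a / (2 - a * cknExponent n a) :=
  div_nonneg (mul_nonneg ha0 (cknExponent_pos hn ha0).le)
    (two_sub_mul_cknExponent_pos hn ha0 ha1).le

theorem lintegral_ratioWeight (hn : 3 ≤ n) (ha0 : 0 ≤ a) (ha1 : a < 1) :
    ∫⁻ t in Set.Ioi (0 : ℝ), ratioWeight n a t = ENNReal.ofReal (euclideanMoment n a) := by
  unfold ratioWeight
  rw [lintegral_const_mul' _ _ ENNReal.ofReal_ne_top, lintegral_radialKernel_mul_rpow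
    (weightExponent_nonneg hn ha0 ha1) (one_lt_div_two_mul_one_sub hn ha0 ha1),
    ← ENNReal.ofReal_mul (unitBallVolume_pos n).le, euclideanMoment]

theorem measurable_ratioWeight_mul_volumeRatio (μ : Measure X) (n : ℕ) (a : ℝ) (x₀ : X)
    (l s : ℝ) :
    Measurable fun t => ratioWeight n a t * volumeRatio μ n x₀ ((l * t) ^ (1 / s)) :=
  (measurable_ratioWeight n a).mul ((measurable_volumeRatio μ n x₀).comp (by fun_prop))

variable [ProperSpace X] [BorelSpace X]

theorem lintegral_momentIntegrand (hμ : PosFiniteOnBoundedOpen μ) (hn : 3 ≤ n) (ha0 : 0 ≤ a)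
    (ha1 : a < 1) (hx₀ : μ {x₀} = 0) {l : ℝ} (hl : 0 < l) :
    ENNReal.ofReal (l ^ ((n : ℝ) / (2 * (1 - a)) - 1)) *
        ∫⁻ x, ENNReal.ofReal (momentIntegrand n a x₀ l x) ∂μ =
      ∫⁻ t in Set.Ioi (0 : ℝ), ratioWeight n a t *
        volumeRatio μ n x₀ ((l * t) ^ (1 / (2 - a * cknExponent n a))) := by
  have hs := two_sub_mul_cknExponent_pos hn ha0 ha1
  have hms := sub_one_mul_two_sub hn ha0 ha1
  refine lintegral_dist_radialProfile hμ (by omega) hx₀ hs (weightExponent_nonneg hn ha0 ha1)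
    (one_lt_div_two_mul_one_sub hn ha0 ha1) ?_ hl
  rw [add_mul, div_mul_cancel₀ _ hs.ne']
  linarith

theorem integrable_momentIntegrand (hμ : PosFiniteOnBoundedOpen μ) (hn : 3 ≤ n) (ha0 : 0 ≤ a)
    (ha1 : a < 1) (hC₀ : 1 ≤ C₀) (hVD : SatisfiesVD μ n C₀) (hAR : SatisfiesAR μ n x₀) {l : ℝ}
    (hl : 0 < l) : Integrable (momentIntegrand n a x₀ l) μ := by
  have hx₀ := measure_singleton_eq_zero_of_VD_of_AR hμ (by omega) hC₀ hVD hAR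
  have h := lintegral_momentIntegrand hμ hn ha0 ha1 hx₀ hl
  have hle : ∫⁻ t in Set.Ioi (0 : ℝ), ratioWeight n a t *
      volumeRatio μ n x₀ ((l * t) ^ (1 / (2 - a * cknExponent n a))) ≤
      ENNReal.ofReal (euclideanMoment n a) * ENNReal.ofReal C₀ := by
    rw [← lintegral_ratioWeight hn ha0 ha1, ← lintegral_mul_const' _ _ ENNReal.ofReal_ne_top]
    refine setLIntegral_mono' measurableSet_Ioi fun t (ht : 0 < t) => ?_
    gcongr
    exact volumeRatio_le hμ (by omega) hC₀ hVD hAR (by positivity)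
  refine ⟨Measurable.aestronglyMeasurable (by unfold momentIntegrand; fun_prop), ?_⟩
  have hnn : 0 ≤ᵐ[μ] momentIntegrand n a x₀ l := Eventually.of_forall fun x => by
    unfold momentIntegrand
    simp only [Pi.zero_apply]
    positivity
  rw [hasFiniteIntegral_iff_ofReal hnn, lt_top_iff_ne_top]
  intro htop
  rw [htop, ENNReal.mul_top (ENNReal.ofReal_pos.2 (Real.rpow_pos_of_pos hl _)).ne'] at h
  rw [← h, top_le_iff] at hle
  exact ENNReal.mul_ne_top ENNReal.ofReal_ne_top ENNReal.ofReal_ne_top hle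

theorem ofReal_mul_integral_momentIntegrand (hμ : PosFiniteOnBoundedOpen μ) (hn : 3 ≤ n)
    (ha0 : 0 ≤ a) (ha1 : a < 1) (hC₀ : 1 ≤ C₀) (hVD : SatisfiesVD μ n C₀)
    (hAR : SatisfiesAR μ n x₀) {l : ℝ} (hl : 0 < l) :
    ENNReal.ofReal (l ^ ((n : ℝ) / (2 * (1 - a)) - 1) * ∫ x, momentIntegrand n a x₀ l x ∂μ) =
      ∫⁻ t in Set.Ioi (0 : ℝ), ratioWeight n a t *
        volumeRatio μ n x₀ ((l * t) ^ (1 / (2 - a * cknExponent n a))) := by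
  rw [ENNReal.ofReal_mul (by positivity), ofReal_integral_eq_lintegral_ofReal
    (integrable_momentIntegrand hμ hn ha0 ha1 hC₀ hVD hAR hl)
    (Eventually.of_forall fun x => by
      unfold momentIntegrand
      simp only [Pi.zero_apply]
      positivity)]
  exact lintegral_momentIntegrand hμ hn ha0 ha1
    (measure_singleton_eq_zero_of_VD_of_AR hμ (by omega) hC₀ hVD hAR) hl

/-- The square of the profile inequality: `2 / p = 1 - 1 / m` on the left, and on the right the
gradient moment is rewritten as `F - l A`. -/
theorem SatisfiesCKN.moment_inequality (hn : 3 ≤ n)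
    (ha0 : 0 ≤ a) (ha1 : a < 1) (hC : 0 < C) (hx₀ : μ {x₀} = 0) (hCKN : SatisfiesCKN μ n a x₀ C)
    {s m γ l : ℝ} (hsdef : s = 2 - a * cknExponent n a) (hmdef : m = (n : ℝ) / (2 * (1 - a)))
    (hγdef : γ = a * cknExponent n a / s) (hl : 0 < l)
    (hint : Integrable (fun x => (dist x₀ x ^ s) ^ (-γ) * (l + dist x₀ x ^ s) ^ (1 - 2 * m)) μ) :
    (∫ x, (dist x₀ x ^ s) ^ (-γ) * (l + dist x₀ x ^ s) ^ (-(2 * m)) ∂μ) ^ (1 - 1 / m) ≤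
      C ^ 2 * ((n : ℝ) - 2) ^ 2 *
        (∫ x, (dist x₀ x ^ s) ^ (-γ) * (l + dist x₀ x ^ s) ^ (1 - 2 * m) ∂μ -
          l * ∫ x, (dist x₀ x ^ s) ^ (-γ) * (l + dist x₀ x ^ s) ^ (-(2 * m)) ∂μ) := by
  have hn' : (3 : ℝ) ≤ n := by exact_mod_cast hn
  have hpos : ∀ᵐ x ∂μ, 0 < dist x₀ x ^ s := by
    have hne : ∀ᵐ x ∂μ, x ≠ x₀ := by rw [ae_iff]; simpa using hx₀
    filter_upwards [hne] with x hx
    exact Real.rpow_pos_of_pos (dist_pos.2 hx.symm) _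
  have hW : Measurable fun x => dist x₀ x ^ s := by fun_prop
  have hA := integrable_rpow_mul_add_rpow_neg hW hpos hl hint
  obtain ⟨hB, hBeq⟩ := integral_rpow_one_sub_mul hW hpos hl hint
  have h := hCKN.lintegral_moment_le hn ha0 ha1 hx₀ hsdef hmdef hγdef hl
  rw [← ofReal_integral_eq_lintegral_ofReal hA (Eventually.of_forall fun x => by
      simp only [Pi.zero_apply]; positivity),
    ← ofReal_integral_eq_lintegral_ofReal hB (Eventually.of_forall fun x => by
      simp only [Pi.zero_apply]; positivity)] at h
  rw [← hBeq]
  have hA0 : 0 ≤ ∫ x, (dist x₀ x ^ s) ^ (-γ) * (l + dist x₀ x ^ s) ^ (-(2 * m)) ∂μ :=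
    integral_nonneg fun x => by simp only [Pi.zero_apply]; positivity
  have hB0 : 0 ≤ ∫ x, (dist x₀ x ^ s) ^ (1 - γ) * (l + dist x₀ x ^ s) ^ (-(2 * m)) ∂μ :=
    integral_nonneg fun x => by simp only [Pi.zero_apply]; positivity
  generalize ∫ x, (dist x₀ x ^ s) ^ (-γ) * (l + dist x₀ x ^ s) ^ (-(2 * m)) ∂μ = A at h hA0 ⊢
  generalize ∫ x, (dist x₀ x ^ s) ^ (1 - γ) * (l + dist x₀ x ^ s) ^ (-(2 * m)) ∂μ = B at h hB0 ⊢
  have hp := cknExponent_pos hn ha0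
  have hmp := sub_one_mul_cknExponent hn ha0 ha1
  have hm := one_lt_div_two_mul_one_sub hn ha0 ha1
  rw [← hmdef] at hmp hm
  rw [← ENNReal.ofReal_mul (by positivity), ENNReal.ofReal_rpow_of_nonneg hA0 (by positivity),
    ENNReal.ofReal_rpow_of_nonneg (by positivity) (by norm_num), ← ENNReal.ofReal_mul hC.le,
    ENNReal.ofReal_le_ofReal_iff (by positivity)] at h
  have h2 := pow_le_pow_left₀ (by positivity) h 2
  rw [mul_pow, ← Real.rpow_mul_natCast hA0, ← Real.rpow_mul_natCast (by positivity),
    show (1 : ℝ) / 2 * (2 : ℕ) = 1 by norm_num, Real.rpow_one, ← mul_assoc] at h2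
  have e : 1 / cknExponent n a * (2 : ℕ) = 1 - 1 / m := by
    have : m ≠ 0 := by linarith
    push_cast
    field_simp
    linarith
  rwa [e] at h2

theorem critical_le_moment (hμ : PosFiniteOnBoundedOpen μ) (hn : 3 ≤ n) (ha0 : 0 ≤ a)
    (ha1 : a < 1) (hC : cknConstant n a ≤ C) (hC₀ : 1 ≤ C₀) (hCKN : SatisfiesCKN μ n a x₀ C)
    (hVD : SatisfiesVD μ n C₀) (hAR : SatisfiesAR μ n x₀) {l : ℝ} (hl : 0 < l) :
    (C⁻¹ * cknConstant n a) ^ ((n : ℝ) / (1 - a)) * euclideanMoment n a ≤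
      l ^ ((n : ℝ) / (2 * (1 - a)) - 1) * ∫ x, momentIntegrand n a x₀ l x ∂μ := by
  have hn' : (3 : ℝ) ≤ n := by exact_mod_cast hn
  have hK := cknConstant_pos hn ha0 ha1
  have hCpos : 0 < C := hK.trans_le hC
  have hMom := euclideanMoment_pos hn ha0 ha1
  have hx₀ := measure_singleton_eq_zero_of_VD_of_AR hμ (by omega) hC₀ hVD hAR
  have hs := two_sub_mul_cknExponent_pos hn ha0 ha1
  have hm := one_lt_div_two_mul_one_sub hn ha0 ha1
  have hintF := fun l (hl : 0 < l) =>
    integrable_momentIntegrand (a := a) (x₀ := x₀) hμ hn ha0 ha1 hC₀ hVD hAR hl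
  have hrep := fun l (hl : 0 < l) =>
    ofReal_mul_integral_momentIntegrand (a := a) (x₀ := x₀) hμ hn ha0 ha1 hC₀ hVD hAR hl
  have hpos : ∀ᵐ x ∂μ, 0 < dist x₀ x ^ (2 - a * cknExponent n a) := by
    have hne : ∀ᵐ x ∂μ, x ≠ x₀ := by rw [ae_iff]; simpa using hx₀
    filter_upwards [hne] with x hx
    exact Real.rpow_pos_of_pos (dist_pos.2 hx.symm) _
  have hFpos : ∀ l, 0 < l → 0 < ∫ x, momentIntegrand n a x₀ l x ∂μ := by
    intro l hl
    have hnn : 0 ≤ momentIntegrand n a x₀ l := fun x => by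
      unfold momentIntegrand
      simp only [Pi.zero_apply]
      positivity
    rw [integral_pos_iff_support_of_nonneg hnn (hintF l hl)]
    refine ((hμ.ball x₀ one_pos).1).trans_le (measure_mono_ae ?_)
    filter_upwards [hpos] with x hx _
    have : 0 < momentIntegrand n a x₀ l x := by unfold momentIntegrand; positivity
    exact this.ne'
  -- A subcritical value at `l` bounds the normalized moment at every smaller parameter, in
  -- particular along `l / (k + 1)`.
  by_contra! hlt
  have hmono : ∀ l', 0 < l' → l' ≤ l →
      l' ^ ((n : ℝ) / (2 * (1 - a)) - 1) * ∫ x, momentIntegrand n a x₀ l' x ∂μ ≤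
        l ^ ((n : ℝ) / (2 * (1 - a)) - 1) * ∫ x, momentIntegrand n a x₀ l x ∂μ := by
    intro l' hl' hll'
    have hc : 0 < C ^ 2 * ((n : ℝ) - 2) ^ 2 := by
      have : (n : ℝ) - 2 ≠ 0 := by linarith
      positivity
    refine normalized_le_of_lt_critical hm hc (critical_identity hn ha0 ha1 rfl hCpos)
      (fun l hl => hasDerivAt_integral_rpow_mul_add_rpow (by fun_prop) hpos hm hintF hl) hFpos
      (fun l hl => integral_nonneg fun x => ?_)
      (fun l hl => hCKN.moment_inequality hn ha0 ha1 hCpos hx₀ rfl rfl rfl hl (hintF l hl))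
      hlt hl' hll'
    simp only [Pi.zero_apply]
    positivity
  have hb1 : (C⁻¹ * cknConstant n a) ^ ((n : ℝ) / (1 - a)) ≤ 1 := by
    refine Real.rpow_le_one (by positivity) ?_ (div_nonneg (by linarith) (by linarith))
    rw [inv_mul_le_iff₀ hCpos, mul_one]
    exact hC
  have hlim : ∀ t, 0 < t → Tendsto
      (fun k : ℕ => (l / ((k : ℝ) + 1) * t) ^ (1 / (2 - a * cknExponent n a))) atTop
      (𝓝[>] 0) := by
    intro t ht
    refine tendsto_nhdsWithin_iff.2 ⟨?_, Eventually.of_forall fun k => ?_⟩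
    · have h1 : Tendsto (fun k : ℕ => l * (1 / ((k : ℝ) + 1)) * t) atTop (𝓝 (l * 0 * t)) :=
        (tendsto_one_div_add_atTop_nhds_zero_nat.const_mul l).mul_const t
      have h2 := h1.rpow_const (p := 1 / (2 - a * cknExponent n a))
        (Or.inr (by positivity))
      rw [mul_zero, zero_mul, Real.zero_rpow (by positivity)] at h2
      simpa only [mul_one_div] using h2
    · exact Set.mem_Ioi.2 (by positivity)
  have hfatou : ENNReal.ofReal (euclideanMoment n a) ≤ ENNReal.ofReal
      (l ^ ((n : ℝ) / (2 * (1 - a)) - 1) * ∫ x, momentIntegrand n a x₀ l x ∂μ) := by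
    calc
      _ ≤ ∫⁻ t in Set.Ioi (0 : ℝ), liminf (fun k : ℕ => ratioWeight n a t * volumeRatio μ n x₀
            ((l / ((k : ℝ) + 1) * t) ^ (1 / (2 - a * cknExponent n a)))) atTop := by
        rw [← lintegral_ratioWeight hn ha0 ha1]
        refine setLIntegral_mono' measurableSet_Ioi fun t (ht : 0 < t) => ?_
        -- The lower limit along one sequence of radii tending to `0⁺` is at least the full lower
        -- limit in (AR), which is all that Fatou requires.
        have h1 : 1 ≤ liminf (fun k : ℕ => volumeRatio μ n x₀
            ((l / ((k : ℝ) + 1) * t) ^ (1 / (2 - a * cknExponent n a)))) atTop := by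
          rw [SatisfiesAR] at hAR
          rw [← hAR]
          exact (liminf_le_liminf_of_le (hlim t ht)).trans_eq
            (liminf_comp (volumeRatio μ n x₀) _ _).symm
        calc ratioWeight n a t = ratioWeight n a t * 1 := (mul_one _).symm
          _ ≤ ratioWeight n a t * liminf (fun k : ℕ => volumeRatio μ n x₀
                ((l / ((k : ℝ) + 1) * t) ^ (1 / (2 - a * cknExponent n a)))) atTop := by
              gcongr
          _ ≤ _ := by
              refine le_trans ?_ ENNReal.le_liminf_mul
              rw [liminf_const]
      _ ≤ liminf (fun k : ℕ => ∫⁻ t in Set.Ioi (0 : ℝ), ratioWeight n a t * volumeRatio μ n x₀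
            ((l / ((k : ℝ) + 1) * t) ^ (1 / (2 - a * cknExponent n a)))) atTop :=
        lintegral_liminf_le fun k => measurable_ratioWeight_mul_volumeRatio μ n a x₀ _ _
      _ ≤ liminf (fun _ : ℕ => ENNReal.ofReal
            (l ^ ((n : ℝ) / (2 * (1 - a)) - 1) * ∫ x, momentIntegrand n a x₀ l x ∂μ)) atTop := by
        refine liminf_le_liminf (Eventually.of_forall fun k => ?_)
        rw [← hrep _ (by positivity)]
        exact ENNReal.ofReal_le_ofReal (hmono _ (by positivity)
          (div_le_self hl.le (by linarith [k.cast_nonneg (α := ℝ)])))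
      _ = _ := liminf_const _
  rw [ENNReal.ofReal_le_ofReal_iff (mul_nonneg (by positivity) (hFpos l hl).le)] at hfatou
  -- The Euclidean moment is at most the value at `l`, which is below the critical level, itself at
  -- most the Euclidean moment by `hb1`.
  nlinarith

theorem rpow_le_mul_measure_ball (hμ : PosFiniteOnBoundedOpen μ) (hn : 3 ≤ n) (ha0 : 0 ≤ a)
    (ha1 : a < 1) (hC : cknConstant n a ≤ C) (hC₀ : 1 ≤ C₀) (hCKN : SatisfiesCKN μ n a x₀ C)
    (hVD : SatisfiesVD μ n C₀) (hAR : SatisfiesAR μ n x₀) (x : X) {ρ : ℝ} (hρ : 0 < ρ) :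
    ENNReal.ofReal ((C⁻¹ * cknConstant n a) ^ ((n : ℝ) / (1 - a))) ≤
      ENNReal.ofReal (C₀ / (unitBallVolume n * ρ ^ n)) * μ (Metric.ball x ρ) := by
  set M := ENNReal.ofReal (C₀ / (unitBallVolume n * ρ ^ n)) * μ (Metric.ball x ρ)
  have hMtop : M ≠ ∞ := ENNReal.mul_ne_top ENNReal.ofReal_ne_top (hμ.ball x hρ).2.ne
  have hMom := euclideanMoment_pos hn ha0 ha1
  have hK := cknConstant_pos hn ha0 ha1
  have hCpos : 0 < C := hK.trans_le hC
  have hs := two_sub_mul_cknExponent_pos hn ha0 ha1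
  have hR : ∀ t, 0 < t → Tendsto
      (fun k : ℕ => (((k : ℝ) + 1) * t) ^ (1 / (2 - a * cknExponent n a))) atTop atTop := by
    intro t ht
    exact (tendsto_rpow_atTop (by positivity)).comp
      ((tendsto_atTop_add_const_right _ _ tendsto_natCast_atTop_atTop).atTop_mul_const ht)
  have hlimsup : ∀ t, 0 < t → limsup (fun k : ℕ => ratioWeight n a t * volumeRatio μ n x₀
      ((((k : ℝ) + 1) * t) ^ (1 / (2 - a * cknExponent n a)))) atTop ≤ ratioWeight n a t * M := by
    intro t ht
    have h1 : Tendsto (fun R : ℝ => ratioWeight n a t *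
        (M * ENNReal.ofReal ((1 + dist x₀ x / R) ^ n))) atTop
        (𝓝 (ratioWeight n a t * (M * ENNReal.ofReal ((1 + 0) ^ n)))) := by
      refine ENNReal.Tendsto.const_mul (ENNReal.Tendsto.const_mul (ENNReal.tendsto_ofReal
        (((tendsto_const_nhds.div_atTop tendsto_id).const_add 1).pow n)) (Or.inr hMtop)) (Or.inr ?_)
      exact ENNReal.mul_ne_top ENNReal.ofReal_ne_top ENNReal.ofReal_ne_top
    rw [add_zero, one_pow, ENNReal.ofReal_one, mul_one] at h1
    rw [← (h1.comp (hR t ht)).limsup_eq]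
    refine limsup_le_limsup ?_
    filter_upwards [(hR t ht).eventually_gt_atTop ρ] with k hk
    exact mul_le_mul' le_rfl (volumeRatio_le_mul hμ (by omega) hC₀ x₀ hVD x hρ hk)
  have hmain : ENNReal.ofReal ((C⁻¹ * cknConstant n a) ^ ((n : ℝ) / (1 - a)) *
      euclideanMoment n a) ≤ ENNReal.ofReal (euclideanMoment n a) * M := by
    calc
      _ = limsup (fun _ : ℕ => ENNReal.ofReal ((C⁻¹ * cknConstant n a) ^ ((n : ℝ) / (1 - a)) *
            euclideanMoment n a)) atTop := (limsup_const _).symm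
      _ ≤ limsup (fun k : ℕ => ∫⁻ t in Set.Ioi (0 : ℝ), ratioWeight n a t * volumeRatio μ n x₀
            ((((k : ℝ) + 1) * t) ^ (1 / (2 - a * cknExponent n a)))) atTop := by
        refine limsup_le_limsup (Eventually.of_forall fun k => ?_)
        have hk : (0 : ℝ) < k + 1 := by positivity
        beta_reduce
        rw [← ofReal_mul_integral_momentIntegrand hμ hn ha0 ha1 hC₀ hVD hAR hk]
        exact ENNReal.ofReal_le_ofReal
          (critical_le_moment hμ hn ha0 ha1 hC hC₀ hCKN hVD hAR hk)
      _ ≤ ∫⁻ t in Set.Ioi (0 : ℝ), limsup (fun k : ℕ => ratioWeight n a t * volumeRatio μ n x₀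
            ((((k : ℝ) + 1) * t) ^ (1 / (2 - a * cknExponent n a)))) atTop := by
        -- Reverse Fatou needs an integrable majorant: the volume ratio is at most `C₀` at every
        -- radius.
        refine limsup_lintegral_le (fun t => ratioWeight n a t * ENNReal.ofReal C₀)
          (fun k => measurable_ratioWeight_mul_volumeRatio μ n a x₀ _ _) (fun k => ?_) ?_
        · filter_upwards [ae_restrict_mem measurableSet_Ioi] with t ht
          have ht' : 0 < t := ht
          exact mul_le_mul' le_rfl
            (volumeRatio_le hμ (by omega) hC₀ hVD hAR (by positivity))
        · rw [lintegral_mul_const' _ _ ENNReal.ofReal_ne_top, lintegral_ratioWeight hn ha0 ha1]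
          exact ENNReal.mul_ne_top ENNReal.ofReal_ne_top ENNReal.ofReal_ne_top
      _ ≤ ∫⁻ t in Set.Ioi (0 : ℝ), ratioWeight n a t * M :=
        setLIntegral_mono' measurableSet_Ioi hlimsup
      _ = _ := by rw [lintegral_mul_const' _ _ hMtop, lintegral_ratioWeight hn ha0 ha1]
  rw [ENNReal.ofReal_mul (by positivity), mul_comm] at hmain
  exact (ENNReal.mul_le_mul_iff_right (ENNReal.ofReal_pos.2 hMom).ne'
    ENNReal.ofReal_ne_top).1 hmain

end Comparison

theorem theorem1p1 {X : Type*} [MetricSpace X] [ProperSpace X] [MeasurableSpace X] [BorelSpace X]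
    (μ : Measure X) (hμ : PosFiniteOnBoundedOpen μ)
    (n : ℕ) (hn : 3 ≤ n) (a : ℝ) (ha0 : 0 ≤ a) (ha1 : a < 1)
    (x₀ : X) (C C₀ : ℝ) (hC : cknConstant n a ≤ C) (hC₀ : 1 ≤ C₀)
    (hCKN : SatisfiesCKN μ n a x₀ C) (hVD : SatisfiesVD μ n C₀) (hAR : SatisfiesAR μ n x₀) :
    (∀ (x : X) (ρ : ℝ), 0 < ρ →
      ENNReal.ofReal (C₀⁻¹ * (C⁻¹ * cknConstant n a) ^ ((n : ℝ) / (1 - a))) *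
          euclideanBallVolume n ρ ≤ μ (Metric.ball x ρ)) ∧
    (∀ ρ : ℝ, 0 < ρ →
      ENNReal.ofReal (C₀⁻¹ * (C⁻¹ * cknConstant n a) ^ ((n : ℝ) / (1 - a)) *
          unitBallVolume n * ρ ^ n) ≤ μ (Metric.ball x₀ ρ) ∧
      μ (Metric.ball x₀ ρ) ≤ ENNReal.ofReal (C₀ * unitBallVolume n * ρ ^ n)) := by
  have hω := unitBallVolume_pos n
  have hK := cknConstant_pos hn ha0 ha1
  have hCpos : 0 < C := hK.trans_le hC
  have hn0 : n ≠ 0 := by omega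
  have hlower : ∀ (x : X) (ρ : ℝ), 0 < ρ →
      ENNReal.ofReal (C₀⁻¹ * (C⁻¹ * cknConstant n a) ^ ((n : ℝ) / (1 - a)) *
          unitBallVolume n * ρ ^ n) ≤ μ (Metric.ball x ρ) := by
    intro x ρ hρ
    have h := rpow_le_mul_measure_ball hμ hn ha0 ha1 hC hC₀ hCKN hVD hAR x hρ
    rw [← ENNReal.div_le_iff' (ENNReal.ofReal_pos.2 (by positivity)).ne'
      ENNReal.ofReal_ne_top, ← ENNReal.ofReal_div_of_pos (by positivity)] at h
    convert h using 2
    field_simp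
  refine ⟨fun x ρ hρ => ?_, fun ρ hρ => ⟨hlower x₀ ρ hρ,
    measure_ball_le_of_VD_of_AR hμ hn0 hC₀ hVD hAR hρ⟩⟩
  rw [euclideanBallVolume_eq hn0 hρ.le, ← ENNReal.ofReal_mul (by positivity), ← mul_assoc]
  exact hlower x ρ hρ
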